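/- Let $K\ge 1$, $[K]=\{1,\dots,K\}$, and let $(\xi,J)$ be a (possibly killed) right-continuous Markov additive process on $(\mathbb R\times[K])\cup\{(+\infty,0)\}$, where $(+\infty,0)$ is absorbing, such that $\xi$ is nondecreasing. Let $\mathbb P_i$ (with expectation $\mathbb E_i$) be its law when started at $(0,i)$. Thus under $\mathbb P_i$, conditionally on $(\xi_u,J_u)_{u\le t}$ and on $\{\xi_t<\infty\}$, the process $(\xi_{t+s}-\xi_t,J_{t+s})_{s\ge 0}$ has law $\mathbb P_{J_t}$. Its parameters are: the transition rate matrix $\mathbf\Lambda=(\lambda_{i,j})$ of the types (nonnegative off the diagonal, with rows summing to $0$), which is assumed irreducible; the laws $B_{i,j}$ on $[0,\infty)$ of the jump of $\xi$ when $J$ jumps from $i$ to $j$ (with $B_{i,i}=\delta_0$); and, for each type $i$, a killing rate $k^{(i)}\ge 0$, a drift $c^{(i)}\ge 0$ and a Lévy measure $\Pi^{(i)}$ on $(0,\infty)$ with $\int(1\wedge x)\,\Pi^{(i)}(\mathrm dx)<\infty$, which govern $\xi$ while $J=i$. That is, the generator of $(\xi,J)$ is $$\mathcal A f(x,i)=c^{(i)}\partial_xf(x,i)+\int_{(0,\infty)}\big(f(x+y,i)-f(x,i)\big)\Pi^{(i)}(\mathrm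 dy)+\sum_{j\in[K]}\lambda_{i,j}\int_{[0,\infty)}\big(f(x+y,j)-f(x,i)\big)B_{i,j}(\mathrm dy)-k^{(i)}f(x,i)$$ for functions $f$ that are $C^1$ and bounded with bounded derivative in $x$ and vanish at the cemetery, in the sense that $\mathbb E_i[f(\xi_t,J_t)]=f(0,i)+\int_0^t\mathbb E_i[\mathcal Af(\xi_s,J_s)]\,\mathrm ds$ for all $t\ge0$ and $i\in[K]$. Let $$\underline p=\inf\Big\{p\in\mathbb R:\ \forall i,\ \int_0^\infty(e^{-px}-1)\,\Pi^{(i)}(\mathrm dx)<\infty\ \text{ and }\ \forall i,j,\ \lambda_{i,j}\int_0^\infty e^{-px}B_{i,j}(\mathrm dx)<\infty\Big\}\in[-\infty,0]$$ (with $0\cdot\infty=0$), and for $p>\underline p$ let $\mathbf\Phi(p)$ be the Bernstein matrix $$\mathbf\Phi(p)_{i,j}=\mathbf 1_{\{i=j\}}\Big(k^{(i)}+c^{(i)}p+\int_0^\infty(1-e^{-px})\,\Pi^{(i)}(\mathrm dx)\Big)-\lambda_{i,j}\int_0^\infty e^{-px}B_{i,j}(\mathrm dx).$$ For a real square matrix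 $\mathbf A$, let $\lambda(\mathbf A)$ be the maximal real part of its complex eigenvalues. Assume that $k^{(i)}>0$ for at least one $i$. Let $T=\inf\{t\ge 0:\xi_t=\infty\}$ be the death time and let $f_i(p)=\mathbb E_i[e^{-p\xi_{T^-}}]\in[0,\infty]$. Then for every real $p>\underline p$ with $-\lambda(-\mathbf\Phi(p))>0$, the matrix $\mathbf\Phi(p)$ is invertible, $f_i(p)<\infty$ for every $i\in[K]$, and, with $\mathbf F(p)=(f_i(p))_{i\in[K]}$ and $\mathbf K=(k^{(i)})_{i\in[K]}$ as column vectors, $$\mathbf F(p)=\mathbf\Phi(p)^{-1}\,\mathbf K.$$ -/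

import Mathlib

open MeasureTheory Set Filter Topology
open scoped NNReal ENNReal

noncomputable section

namespace MAP

/-- The state space `ℝ × {1, …, K} ∪ {(+∞, 0)}` sits inside `EReal × Fin (K + 1)`: a type
`i : Fin K` is the state `i.succ`, and `(⊤, 0)` is the cemetery. -/
abbrev Path (K : ℕ) : Type := ℝ≥0 → EReal × Fin (K + 1)

/-- The sigma-algebra generated by `(ξ_u, J_u)`, `u ≤ t`. -/
abbrev past {Ω : Type*} {K : ℕ} (ξ : ℝ≥0 → Ω → EReal) (J : ℝ≥0 → Ω → Fin (K + 1)) (t : ℝ≥0) :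
    MeasurableSpace Ω :=
  ⨆ u ∈ Set.Iic t, MeasurableSpace.comap (fun ω => (ξ u ω, J u ω)) inferInstance

/-- `(ξ, J)` is a (possibly killed, right-continuous) Markov additive process with `K` types;
`P i` is the law under which it starts at `(0, i)`. -/
structure IsMarkovAdditive {Ω : Type*} [MeasurableSpace Ω] {K : ℕ} (P : Fin K → Measure Ω)
    (ξ : ℝ≥0 → Ω → EReal) (J : ℝ≥0 → Ω → Fin (K + 1)) : Prop where
  isProbabilityMeasure : ∀ i, IsProbabilityMeasure (P i)
  measurable_position : ∀ t, Measurable (ξ t)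
  measurable_type : ∀ t, Measurable (J t)
  position_ne_bot : ∀ t ω, ξ t ω ≠ ⊥
  type_eq_zero_iff : ∀ t ω, J t ω = 0 ↔ ξ t ω = ⊤
  absorbing : ∀ s t ω, s ≤ t → ξ s ω = ⊤ → ξ t ω = ⊤
  position_rightCts : ∀ ω t, ContinuousWithinAt (fun s => ξ s ω) (Set.Ici t) t
  type_rightCts : ∀ ω t, ContinuousWithinAt (fun s => J s ω) (Set.Ici t) t
  start : ∀ i, ∀ᵐ ω ∂(P i), ξ 0 ω = 0 ∧ J 0 ω = i.succ
  /-- Under `P i`, conditionally on the past up to time `t` and on `J_t = j` (so `ξ_t < ∞`), the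
  process `(ξ_{t+s} - ξ_t, J_{t+s})`, `s ≥ 0`, has the law of `(ξ, J)` under `P j`. -/
  markov_additive : ∀ (i : Fin K) (t : ℝ≥0) (A : Set Ω), MeasurableSet[past ξ J t] A →
    ∀ (j : Fin K) (S : Set (Path K)), MeasurableSet S →
      P i (A ∩ {ω | J t ω = j.succ} ∩
          {ω | (fun s => (ξ (t + s) ω - ξ t ω, J (t + s) ω) : Path K) ∈ S}) =
        P i (A ∩ {ω | J t ω = j.succ}) *
          P j {ω | (fun s => (ξ s ω, J s ω) : Path K) ∈ S}

/-- The parameters of a nondecreasing Markov additive process with `K` types. -/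
structure Params (K : ℕ) where
  /-- transition rates of the types -/
  rate : Matrix (Fin K) (Fin K) ℝ
  /-- law of the jump of the position when the type jumps from `i` to `j` -/
  jump : Fin K → Fin K → Measure ℝ
  /-- killing rates -/
  kill : Fin K → ℝ
  /-- drifts -/
  drift : Fin K → ℝ
  /-- Lévy measures on `(0, ∞)`, seen as measures on `ℝ` -/
  levy : Fin K → Measure ℝ
  rate_nonneg : ∀ i j, i ≠ j → 0 ≤ rate i j
  rate_sum : ∀ i, ∑ j, rate i j = 0
  jump_prob : ∀ i j, IsProbabilityMeasure (jump i j)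
  jump_neg : ∀ i j, jump i j (Set.Iio 0) = 0
  jump_self : ∀ i, jump i i = Measure.dirac 0
  kill_nonneg : ∀ i, 0 ≤ kill i
  drift_nonneg : ∀ i, 0 ≤ drift i
  levy_nonpos : ∀ i, levy i (Set.Iic 0) = 0
  levy_finite : ∀ i, ∫⁻ x, ENNReal.ofReal (min 1 x) ∂(levy i) < ⊤

namespace Params

variable {K : ℕ} (M : Params K)

/-- The chain of types is irreducible. -/
def Irreducible : Prop :=
  ∀ i j, Relation.ReflTransGen (fun a b => 0 < M.rate a b) i j

/-- The Laplace exponent `ψ_i`. -/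
def laplaceExponent (i : Fin K) (p : ℝ) : ℝ :=
  M.kill i + M.drift i * p + ∫ x, (1 - Real.exp (-p * x)) ∂(M.levy i)

/-- The Laplace transform of the law of the jump at a change of type. -/
def jumpLaplace (p : ℝ) : Matrix (Fin K) (Fin K) ℝ :=
  Matrix.of fun i j => ∫ x, Real.exp (-p * x) ∂(M.jump i j)

/-- The Bernstein matrix `Φ(p) = diag(ψ_i(p)) - Λ ∘ B̂(p)`. -/
def bernstein (p : ℝ) : Matrix (Fin K) (Fin K) ℝ :=
  Matrix.diagonal (fun i => M.laplaceExponent i p) - Matrix.hadamard M.rate (M.jumpLaplace p)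

/-- The integrals that define `Φ(p)` are finite (with the convention `0 * ∞ = 0`). -/
def FiniteAt (p : ℝ) : Prop :=
  (∀ i, ∫⁻ x, ENNReal.ofReal (Real.exp (-p * x) - 1) ∂(M.levy i) < ⊤) ∧
    ∀ i j, ENNReal.ofReal (M.rate i j) *
      ∫⁻ x, ENNReal.ofReal (Real.exp (-p * x)) ∂(M.jump i j) < ⊤

/-- The threshold `p̲`, possibly `-∞`. -/
def lowerExponent : EReal := sInf ((fun p : ℝ => (p : EReal)) '' {p | M.FiniteAt p})

/-- The generator of the process: drift, jumps within a type, jumps at changes of type, killing. -/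
def generator (f : Fin K → ℝ → ℝ) (i : Fin K) (x : ℝ) : ℝ :=
  M.drift i * deriv (f i) x + ∫ y, (f i (x + y) - f i x) ∂(M.levy i) +
    ∑ j, M.rate i j * ∫ y, (f j (x + y) - f i x) ∂(M.jump i j) - M.kill i * f i x

end Params

/-- A function of position and type, extended by `0` to the cemetery. -/
def extend {K : ℕ} (f : Fin K → ℝ → ℝ) (x : EReal) (j : Fin (K + 1)) : ℝ :=
  Fin.cases (motive := fun _ => ℝ) 0 (fun i => f i x.toReal) j

/-- The test functions: of class `C¹` in the position, bounded with bounded derivative. -/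
def IsTest {K : ℕ} (f : Fin K → ℝ → ℝ) : Prop :=
  (∀ i, ContDiff ℝ 1 (f i)) ∧ ∃ C : ℝ, ∀ i x, |f i x| ≤ C ∧ |deriv (f i) x| ≤ C

/-- `(ξ, J)` is a nondecreasing Markov additive process with parameters `M`: it is Markov additive,
`ξ` is nondecreasing, and its generator is the one with parameters `M`. -/
structure IsNondecreasing {Ω : Type*} [MeasurableSpace Ω] {K : ℕ} (M : Params K)
    (P : Fin K → Measure Ω) (ξ : ℝ≥0 → Ω → EReal) (J : ℝ≥0 → Ω → Fin (K + 1)) : Prop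
    extends IsMarkovAdditive P ξ J where
  monotone : ∀ ω, Monotone fun t => ξ t ω
  dynkin : ∀ f : Fin K → ℝ → ℝ, IsTest f → ∀ (i : Fin K) (t : ℝ≥0),
    ∫ ω, extend f (ξ t ω) (J t ω) ∂(P i) = f i 0 +
      ∫ s in (0 : ℝ)..t,
        ∫ ω, extend (M.generator f) (ξ s.toNNReal ω) (J s.toNNReal ω) ∂(P i)

/-- The death time `T = inf {t | ξ_t = ∞}`. -/
def deathTime {Ω : Type*} (ξ : ℝ≥0 → Ω → EReal) (ω : Ω) : ℝ≥0∞ :=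
  sInf ((fun t : ℝ≥0 => (t : ℝ≥0∞)) '' {t | ξ t ω = ⊤})

/-- `ξ_{T-}`, the left limit at the death time: for a nondecreasing path it is the supremum of the
positions at times `t < T`. -/
def deathPosition {Ω : Type*} (ξ : ℝ≥0 → Ω → EReal) (ω : Ω) : EReal :=
  ⨆ (t : ℝ≥0) (_ : (t : ℝ≥0∞) < deathTime ξ ω), ξ t ω

/-- The moment `E[exp(-p ξ_{T-})]`, in `[0, ∞]`. -/
def deathMoment {Ω : Type*} [MeasurableSpace Ω] (μ : Measure Ω) (ξ : ℝ≥0 → Ω → EReal)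
    (p : ℝ) : ℝ≥0∞ :=
  ∫⁻ ω, EReal.exp (-(p : EReal) * deathPosition ξ ω) ∂μ

/-- `λ(A)`, the maximal real part of the complex eigenvalues of a real matrix `A`. -/
def maxRealPart {K : ℕ} (A : Matrix (Fin K) (Fin K) ℝ) : ℝ :=
  sSup (Complex.re '' spectrum ℂ (A.map Complex.ofReal))

end MAP

end

/-! Let m(t) be the matrix with entries E_i[exp(-p ξ_t); J_t = j], and write Φ for Φ(p). The
generator sends v_j exp(-p x) to -(Φ v)_i exp(-p x), so m' = -m Φ and m(t) = exp(-tΦ)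
(`momentMatrix_eq_exp`). Since exp(-p x) is not a bounded test function on ℝ unless p = 0, it is
approximated by g(x) = 1 / (exp(p x) + ε) (`truncExp`). The generator satisfies |A g| ≤ C g with C
independent of ε (`exists_generator_bound`). Gronwall's inequality, Fatou's lemma and dominated
convergence then remove ε.

Now cut time into steps of length h and let q_h(j) be the probability of death by time h from type
j. The Markov property at time nh gives E_i[exp(-p ξ_{nh}); nh < T ≤ (n+1)h] = (m(nh) q_h)_i
(`lintegral_gridTerm`). The spectral hypothesis puts all eigenvalues of exp(-hΦ) in the open unit
disc, so the sum over n is (1 - exp(-hΦ))⁻¹ q_h. Because q_h / h tends to the vector of killing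
rates (`tendsto_deathProb`) and (1 - exp(-hΦ)) / h tends to Φ, this converges to Φ⁻¹ times that
vector.

On a path that dies, the sum over n is the weight at the last grid time before death, and it tends
to exp(-p ξ_{T-}). On an immortal path it is 0; the summability of m(n) forces exp(-p ξ_n) → 0
almost surely there, so the weight at the limit is 0 as well (`tendsto_tsum_gridTerm`). Limit and
expectation are exchanged by domination by 1 if p ≥ 0, and by Fatou together with a monotone bound
if p ≤ 0 (`deathMoment_eq`). -/

namespace MAP

/-! ### Spectra, geometric series and differential equations for matrix exponentials -/

section Matrices

open scoped Matrix Matrix.Norms.Operator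

variable {n : Type*} [Fintype n] [DecidableEq n]

/-- Spectral mapping for the exponential of a complex matrix. -/
theorem exists_mem_spectrum_of_mem_spectrum_exp (A : Matrix n n ℂ) {μ : ℂ}
    (hμ : μ ∈ spectrum ℂ (NormedSpace.exp A)) : ∃ z ∈ spectrum ℂ A, μ = Complex.exp z := by
  rw [← AlgEquiv.spectrum_eq (Matrix.toLinAlgEquiv' (R := ℂ) (n := n)),
    ← Module.End.hasEigenvalue_iff_mem_spectrum] at hμ
  set E := Matrix.toLinAlgEquiv' (NormedSpace.exp A)
  set a := Matrix.toLinAlgEquiv' A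
  have hc : Commute a E := by
    have : Commute A (NormedSpace.exp A) := (Commute.refl A).exp_right
    exact this.map Matrix.toLinAlgEquiv'
  -- `A` commutes with its exponential, so it preserves the eigenspace for `μ` and has an
  -- eigenvector `v` inside it. The exponential series applied to `v` then identifies `μ`.
  have hmap : MapsTo a (Module.End.eigenspace E μ) (Module.End.eigenspace E μ) :=
    Module.End.mapsTo_genEigenspace_of_comm hc.symm μ 1
  have : Nontrivial (Module.End.eigenspace E μ) :=
    Submodule.nontrivial_iff_ne_bot.mpr hμ
  obtain ⟨z, hz⟩ := Module.End.exists_eigenvalue (a.restrict hmap)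
  obtain ⟨v, hv⟩ := hz.exists_hasEigenvector
  have hv0 : (v : n → ℂ) ≠ 0 := by simpa using hv.2
  have hav : A *ᵥ (v : n → ℂ) = z • (v : n → ℂ) := by
    have := congrArg Subtype.val hv.apply_eq_smul
    exact this
  have hEv : NormedSpace.exp A *ᵥ (v : n → ℂ) = μ • (v : n → ℂ) := by
    have := Module.End.mem_eigenspace_iff.mp v.2
    simpa [E] using this
  have hpow : ∀ k : ℕ, (A ^ k) *ᵥ (v : n → ℂ) = z ^ k • (v : n → ℂ) := by
    intro k
    induction k with
    | zero => simp
    | succ k ih =>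
      rw [pow_succ, ← Matrix.mulVec_mulVec, hav, Matrix.mulVec_smul, ih, smul_smul, pow_succ',]
  have h1 := (NormedSpace.exp_series_hasSum_exp' (𝕂 := ℂ) A).map
    (Matrix.mulVecBilin ℂ ℂ |>.flip (v : n → ℂ)) (by
      exact continuous_id.matrix_mulVec continuous_const)
  have h2 := (NormedSpace.exp_series_hasSum_exp' (𝕂 := ℂ) z).smul_const (v : n → ℂ)
  have h3 : NormedSpace.exp A *ᵥ (v : n → ℂ) = NormedSpace.exp z • (v : n → ℂ) := by
    refine h1.unique ?_
    convert h2 using 2 with k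
    simp [hpow, smul_smul]
  refine ⟨z, ?_, ?_⟩
  · rw [← AlgEquiv.spectrum_eq (Matrix.toLinAlgEquiv' (R := ℂ) (n := n)),
      ← Module.End.hasEigenvalue_iff_mem_spectrum]
    exact Module.End.hasEigenvalue_of_hasEigenvector
      (x := (v : n → ℂ)) ⟨Module.End.mem_eigenspace_iff.mpr (by simpa using hav), hv0⟩
  · rw [hEv, ← Complex.exp_eq_exp_ℂ] at h3
    exact smul_left_injective ℂ hv0 h3

/-- By Gelfand's formula ‖B^k‖^(1/k) tends to the spectral radius, which is below 1, so the powers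
are eventually dominated by a geometric series. -/
theorem summable_pow_of_forall_norm_lt_one (B : Matrix n n ℂ)
    (hB : ∀ z ∈ spectrum ℂ B, ‖z‖ < 1) : Summable (fun k => B ^ k) := by
  rcases isEmpty_or_nonempty n with hn | hn
  · convert summable_zero with k
    exact Subsingleton.elim _ _
  have hr : spectralRadius ℂ B < 1 := by
    have := spectrum.spectralRadius_lt_of_forall_lt B (r := 1) (by
      intro z hz; exact_mod_cast hB z hz)
    simpa using this
  obtain ⟨r, hr1, hr2⟩ := exists_between hr
  lift r to ℝ≥0 using (hr2.trans ENNReal.one_lt_top).ne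
  have hr2 : r < 1 := by exact_mod_cast hr2
  have hev := (spectrum.pow_nnnorm_pow_one_div_tendsto_nhds_spectralRadius B).eventually
    (gt_mem_nhds hr1)
  refine summable_of_isBigO_nat (g := fun k => (r : ℝ) ^ k)
    (summable_geometric_of_lt_one r.2 hr2) (Asymptotics.IsBigO.of_bound 1 ?_)
  filter_upwards [hev, eventually_gt_atTop 0] with k hk hk0
  have hk' : (‖B ^ k‖₊ : ℝ≥0∞) ≤ (r : ℝ≥0∞) ^ k := by
    have h := ENNReal.rpow_le_rpow hk.le (z := k) (by positivity)
    rwa [← ENNReal.rpow_mul, one_div, inv_mul_cancel₀ (by positivity), ENNReal.rpow_one,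
      ENNReal.rpow_natCast] at h
  have : ‖B ^ k‖₊ ≤ r ^ k := by exact_mod_cast hk'
  have h' : ‖B ^ k‖ ≤ (r : ℝ) ^ k := by exact_mod_cast this
  simpa using h'.trans (le_abs_self _)

theorem map_ofReal_exp (A : Matrix n n ℝ) :
    (NormedSpace.exp A).map Complex.ofReal = NormedSpace.exp (A.map Complex.ofReal) := by
  have := NormedSpace.map_exp (Complex.ofRealHom.mapMatrix (m := n))
    (by exact continuous_id.matrix_map Complex.continuous_ofReal) A
  exact this

theorem summable_pow_of_map_ofReal {B : Matrix n n ℝ}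
    (hB : Summable (fun k => (B.map Complex.ofReal) ^ k)) : Summable (fun k => B ^ k) := by
  have := hB.map (Complex.reAddGroupHom.mapMatrix (m := n) (n := n))
    (by exact continuous_id.matrix_map Complex.continuous_re)
  convert this using 2 with k
  have h := map_pow (Complex.ofRealHom.mapMatrix (m := n)) B k
  change (B ^ k).map Complex.ofReal = (B.map Complex.ofReal) ^ k at h
  simp only [Function.comp]
  ext i j
  have h' := congrArg (fun M => (M i j).re) h
  simpa using h'

/-- The spectrum is compact, so the `sSup` in `maxRealPart` is over a bounded set and really
dominates each real part. -/
theorem re_neg_of_neg_maxRealPart_pos {K : ℕ} {A : Matrix (Fin K) (Fin K) ℝ}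
    (h : 0 < -maxRealPart A) {z : ℂ} (hz : z ∈ spectrum ℂ (A.map Complex.ofReal)) : z.re < 0 := by
  have hb : BddAbove (Complex.re '' spectrum ℂ (A.map Complex.ofReal)) :=
    ((spectrum.isCompact (𝕜 := ℂ) (A.map Complex.ofReal)).image Complex.continuous_re).bddAbove
  have := le_csSup hb ⟨z, hz, rfl⟩
  unfold maxRealPart at h
  linarith

theorem isUnit_of_neg_maxRealPart_neg_pos {K : ℕ} {Φ : Matrix (Fin K) (Fin K) ℝ}
    (h : 0 < -maxRealPart (-Φ)) : IsUnit Φ := by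
  have h0 : (0 : ℂ) ∉ spectrum ℂ ((-Φ).map Complex.ofReal) := fun h0 => by
    simpa using re_neg_of_neg_maxRealPart_pos h h0
  rw [spectrum.zero_notMem_iff, Matrix.isUnit_iff_isUnit_det, isUnit_iff_ne_zero] at h0
  have hdet : ((-Φ).map Complex.ofReal).det = ((-Φ).det : ℂ) :=
    (Complex.ofRealHom.map_det (-Φ)).symm
  rw [hdet] at h0
  rw [← IsUnit.neg_iff, Matrix.isUnit_iff_isUnit_det, isUnit_iff_ne_zero]
  exact_mod_cast h0

/-- Each eigenvalue of the exponential is exp(t w) with `w` an eigenvalue of `-Φ`; since Re w < 0,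
its modulus is below 1. -/
theorem summable_exp_pow {K : ℕ} {Φ : Matrix (Fin K) (Fin K) ℝ}
    (h : 0 < -maxRealPart (-Φ)) {t : ℝ} (ht : 0 < t) :
    Summable (fun k => (NormedSpace.exp (-(t • Φ))) ^ k) := by
  refine summable_pow_of_map_ofReal (summable_pow_of_forall_norm_lt_one _ fun μ hμ => ?_)
  rw [map_ofReal_exp] at hμ
  obtain ⟨z, hz, rfl⟩ := exists_mem_spectrum_of_mem_spectrum_exp _ hμ
  have he : (-(t • Φ)).map Complex.ofReal = (t : ℂ) • (-Φ).map Complex.ofReal := by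
    ext i j; simp
  have htC : (t : ℂ) ≠ 0 := by exact_mod_cast ht.ne'
  rw [he, show (t : ℂ) • (-Φ).map Complex.ofReal =
    (Units.mk0 (t : ℂ) htC) • (-Φ).map Complex.ofReal from rfl, spectrum.unit_smul_eq_smul] at hz
  obtain ⟨w, hw, rfl⟩ := hz
  have := re_neg_of_neg_maxRealPart_pos h hw
  rw [Complex.norm_exp, Real.exp_lt_one_iff]
  change ((t : ℂ) * w).re < 0
  rw [Complex.re_ofReal_mul]
  exact mul_neg_of_pos_of_neg ht this

theorem hasSum_exp_pow {K : ℕ} {Φ : Matrix (Fin K) (Fin K) ℝ}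
    (h : 0 < -maxRealPart (-Φ)) {t : ℝ} (ht : 0 < t) :
    HasSum (fun k => (NormedSpace.exp (-(t • Φ))) ^ k) (1 - NormedSpace.exp (-(t • Φ)))⁻¹ := by
  have hs := summable_exp_pow h ht
  rw [Matrix.inv_eq_left_inv hs.tsum_pow_mul_one_sub]
  exact hs.hasSum

theorem hasDerivAt_exp_neg_smul (Φ : Matrix n n ℝ) (t : ℝ) :
    HasDerivAt (fun t : ℝ => NormedSpace.exp (-(t • Φ))) (-(NormedSpace.exp (-(t • Φ)) * Φ)) t := by
  have := hasDerivAt_exp_smul_const (-Φ) t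
  simp only [smul_neg, mul_neg] at this
  exact this

/-- Multiply and divide by `t`: (1 - exp(-tΦ)) / t tends to `Φ`, by the derivative of the
exponential at 0, and inversion is continuous at the invertible matrix `Φ`. -/
theorem tendsto_one_sub_exp_inv_mulVec {K : ℕ} {Φ : Matrix (Fin K) (Fin K) ℝ} 
    (h : 0 < -maxRealPart (-Φ)) {q : ℝ → Fin K → ℝ} {k : Fin K → ℝ}
    (hq : Tendsto (fun t => t⁻¹ • q t) (𝓝[>] 0) (𝓝 k)) :
    Tendsto (fun t : ℝ => (1 - NormedSpace.exp (-(t • Φ)))⁻¹ *ᵥ q t) (𝓝[>] 0) (𝓝 (Φ⁻¹ *ᵥ k)) := by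
  have h1 : Tendsto (fun t : ℝ => t⁻¹ • (1 - NormedSpace.exp (-(t • Φ)))) (𝓝[>] 0) (𝓝 Φ) := by
    have := (hasDerivAt_exp_neg_smul Φ 0).hasDerivWithinAt (s := Ioi 0)
    rw [hasDerivWithinAt_iff_tendsto_slope' (by simp)] at this
    have := this.neg
    simp only [slope_fun_def, zero_smul, neg_zero, NormedSpace.exp_zero, one_mul, neg_neg] at this
    refine this.congr fun t => ?_
    simp [smul_sub]
  have hdet : Φ.det ≠ 0 := by
    rw [← isUnit_iff_ne_zero, ← Matrix.isUnit_iff_isUnit_det]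
    exact isUnit_of_neg_maxRealPart_neg_pos h
  have h2 : Tendsto (fun t : ℝ => (t⁻¹ • (1 - NormedSpace.exp (-(t • Φ))))⁻¹) (𝓝[>] 0)
      (𝓝 Φ⁻¹) := by
    simp only [Matrix.inv_def, Ring.inverse_eq_inv']
    have hd : Tendsto (fun M : Matrix (Fin K) (Fin K) ℝ => (M.det)⁻¹ • M.adjugate) (𝓝 Φ)
        (𝓝 ((Φ.det)⁻¹ • Φ.adjugate)) :=
      ((continuous_id.matrix_det.tendsto Φ).inv₀ hdet).smul
        (continuous_id.matrix_adjugate.tendsto Φ)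
    exact hd.comp h1
  have h3 : Tendsto (fun t : ℝ => (t⁻¹ • (1 - NormedSpace.exp (-(t • Φ))))⁻¹ *ᵥ (t⁻¹ • q t))
      (𝓝[>] 0) (𝓝 (Φ⁻¹ *ᵥ k)) :=
    (((continuous_fst.matrix_mulVec continuous_snd).tendsto (Φ⁻¹, k)).comp
      (h2.prodMk_nhds hq))
  refine h3.congr' ?_
  filter_upwards [self_mem_nhdsWithin] with t ht
  have ht : (0 : ℝ) < t := ht
  have hu := (Matrix.isUnit_iff_isUnit_det _).mp
    (IsUnit.of_mul_eq_one_right _ (summable_exp_pow h ht).tsum_pow_mul_one_sub)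
  have := Matrix.inv_smul' (1 - NormedSpace.exp (-(t • Φ))) (Units.mk0 t⁻¹ (inv_pos.mpr ht).ne') hu
  change (t⁻¹ • (1 - NormedSpace.exp (-(t • Φ))))⁻¹ = (t⁻¹)⁻¹ • (1 - NormedSpace.exp (-(t • Φ)))⁻¹
    at this
  rw [this, inv_inv, Matrix.smul_mulVec, Matrix.mulVec_smul, smul_smul, mul_inv_cancel₀ ht.ne',
    one_smul]

/-- Uniqueness for a linear equation, using right derivatives only: the difference D of the two
solutions has D' = -D Φ, so ‖D'‖ ≤ ‖Φ‖ ‖D‖ and D vanishes by Gronwall. -/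
theorem eq_exp_of_hasDerivWithinAt {Φ : Matrix n n ℝ} {m : ℝ → Matrix n n ℝ}
    (h0 : m 0 = 1) (hc : ContinuousOn m (Ici 0))
    (hd : ∀ t, 0 ≤ t → HasDerivWithinAt m (-(m t * Φ)) (Ici t) t) {t : ℝ} (ht : 0 ≤ t) :
    m t = NormedSpace.exp (-(t • Φ)) := by
  have hcexp : Continuous (fun t : ℝ => NormedSpace.exp (-(t • Φ))) :=
    continuous_iff_continuousAt.mpr fun t => (hasDerivAt_exp_neg_smul Φ t).continuousAt
  have := eq_zero_of_abs_deriv_le_mul_abs_self_of_eq_zero_right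
    (f := fun t => m t - NormedSpace.exp (-(t • Φ)))
    (f' := fun t => -(m t * Φ) - -(NormedSpace.exp (-(t • Φ)) * Φ)) (K := ‖Φ‖) (a := 0) (b := t)
    ((hc.mono Icc_subset_Ici_self).sub hcexp.continuousOn)
    (fun s hs => (hd s hs.1).sub (hasDerivAt_exp_neg_smul Φ s).hasDerivWithinAt)
    (by simp [h0])
    (fun s hs => by
      rw [show -(m s * Φ) - -(NormedSpace.exp (-(s • Φ)) * Φ)
        = -((m s - NormedSpace.exp (-(s • Φ))) * Φ) by rw [sub_mul]; abel, norm_neg, mul_comm]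
      exact norm_mul_le _ _) t ⟨ht, le_rfl⟩
  exact sub_eq_zero.mp this

end Matrices

/-! ### A bounded approximation of the exponential -/

/-- A bounded function that increases to `exp (-p x)` as `ε ↓ 0`. -/
noncomputable def truncExp (p ε x : ℝ) : ℝ := (Real.exp (p * x) + ε)⁻¹

section TruncExp

variable {p ε : ℝ}

theorem truncExp_pos (hε : 0 < ε) (x : ℝ) : 0 < truncExp p ε x := by
  unfold truncExp; positivity

theorem truncExp_le_inv (hε : 0 < ε) (x : ℝ) : truncExp p ε x ≤ ε⁻¹ := by
  unfold truncExp
  gcongr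
  linarith [Real.exp_pos (p * x)]

theorem truncExp_le_exp (hε : 0 < ε) (x : ℝ) : truncExp p ε x ≤ Real.exp (-p * x) := by
  rw [neg_mul, Real.exp_neg]
  unfold truncExp
  gcongr
  linarith

theorem contDiff_truncExp (hε : 0 < ε) : ContDiff ℝ 1 (truncExp p ε) := by
  unfold truncExp
  refine ContDiff.inv (by fun_prop) fun x => ?_
  positivity

theorem continuous_truncExp (hε : 0 < ε) : Continuous (truncExp p ε) :=
  (contDiff_truncExp hε).continuous

theorem hasDerivAt_truncExp (hε : 0 < ε) (x : ℝ) :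
    HasDerivAt (truncExp p ε) (-p * Real.exp (p * x) * truncExp p ε x * truncExp p ε x) x := by
  have h1 : HasDerivAt (fun x => Real.exp (p * x) + ε) (Real.exp (p * x) * p) x := by
    simpa using (((hasDerivAt_id x).const_mul p).exp).add_const ε
  have h2 := h1.inv (by positivity)
  have e : -p * Real.exp (p * x) * truncExp p ε x * truncExp p ε x =
      -(Real.exp (p * x) * p) / (Real.exp (p * x) + ε) ^ 2 := by
    unfold truncExp
    field_simp
  rw [e]
  exact h2

theorem exp_mul_truncExp_le_one (hε : 0 < ε) (x : ℝ) :
    Real.exp (p * x) * truncExp p ε x ≤ 1 := by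
  unfold truncExp
  rw [← div_eq_mul_inv, div_le_one (by positivity)]
  linarith

theorem deriv_truncExp (hε : 0 < ε) (x : ℝ) :
    deriv (truncExp p ε) x = -p * Real.exp (p * x) * truncExp p ε x * truncExp p ε x :=
  (hasDerivAt_truncExp hε x).deriv

theorem abs_deriv_truncExp_le (hε : 0 < ε) (x : ℝ) :
    |deriv (truncExp p ε) x| ≤ |p| * truncExp p ε x := by
  have h0 := truncExp_pos (p := p) hε x
  rw [deriv_truncExp hε, abs_mul, abs_of_pos h0, mul_assoc (-p), abs_mul, abs_neg,
    abs_of_pos (a := Real.exp (p * x) * truncExp p ε x) (by positivity)]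
  gcongr
  exact mul_le_of_le_one_right (abs_nonneg p) (exp_mul_truncExp_le_one hε x)

/-- The bound is relative to the value at `x` and its factor does not involve `ε`. That factor is
integrable against the Lévy measures, which makes every later estimate uniform in `ε`. -/
theorem abs_truncExp_sub_le (hε : 0 < ε) (x y : ℝ) :
    |truncExp p ε (x + y) - truncExp p ε x| ≤ |1 - Real.exp (-p * y)| * truncExp p ε x := by
  have hx := truncExp_pos (p := p) hε x
  have key : truncExp p ε (x + y) - truncExp p ε x =
      -(1 - Real.exp (-p * y)) * truncExp p ε x *
        (Real.exp (p * (x + y)) * truncExp p ε (x + y)) := by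
    unfold truncExp
    rw [neg_mul p, Real.exp_neg, mul_add, Real.exp_add]
    field_simp
    ring
  rw [key, abs_mul, abs_mul, abs_neg, abs_of_pos hx,
    abs_of_pos (a := _ * truncExp p ε (x + y)) (mul_pos (Real.exp_pos _) (truncExp_pos hε _))]
  exact mul_le_of_le_one_right (by positivity) (exp_mul_truncExp_le_one hε _)

theorem truncExp_add_le (hε : 0 < ε) (x y : ℝ) :
    truncExp p ε (x + y) ≤ (2 + Real.exp (-p * y)) * truncExp p ε x := by
  have hx := truncExp_pos (p := p) hε x
  have h1 := (abs_le.mp (abs_truncExp_sub_le (p := p) hε x y)).2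
  have h2 : |1 - Real.exp (-p * y)| ≤ 1 + Real.exp (-p * y) := by
    refine (abs_sub _ _).trans ?_
    rw [abs_one, Real.abs_exp]
  nlinarith

theorem tendsto_truncExp (p x : ℝ) :
    Tendsto (fun ε => truncExp p ε x) (𝓝[>] 0) (𝓝 (Real.exp (-p * x))) := by
  have : ContinuousAt (fun ε => truncExp p ε x) 0 := by
    unfold truncExp
    refine ContinuousAt.inv₀ (by fun_prop) (by simp)
  have h : Tendsto (fun ε => truncExp p ε x) (𝓝[>] 0) (𝓝 (truncExp p 0 x)) :=
    this.tendsto.mono_left nhdsWithin_le_nhds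
  simpa [truncExp, ← Real.exp_neg] using h

theorem tendsto_deriv_truncExp (p x : ℝ) :
    Tendsto (fun ε => deriv (truncExp p ε) x) (𝓝[>] 0) (𝓝 (-p * Real.exp (-p * x))) := by
  have h := ((tendsto_truncExp p x).const_mul (-p * Real.exp (p * x))).mul (tendsto_truncExp p x)
  have e : -p * Real.exp (p * x) * Real.exp (-p * x) * Real.exp (-p * x)
      = -p * Real.exp (-p * x) := by
    rw [mul_assoc (-p), ← Real.exp_add]; simp
  rw [e] at h
  refine h.congr' ?_
  filter_upwards [self_mem_nhdsWithin] with ε hε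
  exact (deriv_truncExp hε x).symm

theorem isTest_truncExp {K : ℕ} (hε : 0 < ε) (v : Fin K → ℝ) :
    IsTest fun j x => v j * truncExp p ε x := by
  refine ⟨fun i => contDiff_const.mul (contDiff_truncExp hε),
    (∑ j, |v j|) * (1 + |p|) * ε⁻¹, fun i x => ?_⟩
  have hv : |v i| ≤ ∑ j, |v j| :=
    Finset.single_le_sum (f := fun j => |v j|) (fun _ _ => abs_nonneg _) (Finset.mem_univ i)
  have hx := truncExp_pos (p := p) hε x
  have hle := truncExp_le_inv (p := p) hε x
  have hd : deriv (fun x => v i * truncExp p ε x) x = v i * deriv (truncExp p ε) x :=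
    deriv_const_mul_field _
  rw [hd, abs_mul, abs_mul, abs_of_pos hx, mul_assoc]
  have h0 := abs_nonneg p
  have hε' := inv_pos.mpr hε
  constructor
  · gcongr
    nlinarith
  · gcongr
    refine (abs_deriv_truncExp_le hε x).trans ?_
    nlinarith

end TruncExp

/-! ### Integrability and the generator -/

namespace Params

variable {K : ℕ} (M : Params K) {p : ℝ}

theorem ae_levy_pos (i : Fin K) : ∀ᵐ y ∂(M.levy i), 0 < y := by
  rw [ae_iff]
  simpa [Iic_def] using M.levy_nonpos i

theorem ae_jump_nonneg (i j : Fin K) : ∀ᵐ y ∂(M.jump i j), 0 ≤ y := by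
  rw [ae_iff]
  simpa [Iio_def] using M.jump_neg i j

theorem exists_finiteAt_lt (hp : M.lowerExponent < (p : EReal)) : ∃ r < p, M.FiniteAt r := by
  obtain ⟨_, ⟨r, hr, rfl⟩, hlt⟩ := sInf_lt_iff.mp hp
  exact ⟨r, EReal.coe_lt_coe_iff.mp hlt, hr⟩

/-- For p ≥ 0 and y > 0, 1 - exp(-p y) ≤ (1 + p) min(1, y). For p < 0 the integrand is dominated by
the one at an admissible exponent r < p. -/
theorem integrable_levy (hp : M.lowerExponent < (p : EReal)) (i : Fin K) :
    Integrable (fun y => 1 - Real.exp (-p * y)) (M.levy i) := by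
  refine ⟨by fun_prop, ?_⟩
  rw [hasFiniteIntegral_iff_norm]
  rcases le_or_gt 0 p with h | h
  · refine lt_of_le_of_lt (lintegral_mono_ae (g := fun y =>
      ENNReal.ofReal (1 + p) * ENNReal.ofReal (min 1 y)) ?_) ?_
    · filter_upwards [M.ae_levy_pos i] with y hy
      rw [← ENNReal.ofReal_mul (by positivity)]
      refine ENNReal.ofReal_le_ofReal ?_
      have h1 : 0 ≤ p * y := by positivity
      have h2 := Real.add_one_le_exp (-p * y)
      have h3 := Real.exp_pos (-p * y)
      have h4 : Real.exp (-p * y) ≤ 1 := Real.exp_le_one_iff.mpr (by linarith)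
      rw [Real.norm_eq_abs, abs_of_nonneg (by linarith)]
      rcases min_cases 1 y with ⟨e, _⟩ | ⟨e, _⟩ <;> rw [e] <;> nlinarith
    · rw [lintegral_const_mul _ (by fun_prop)]
      exact ENNReal.mul_lt_top ENNReal.ofReal_lt_top (M.levy_finite i)
  · obtain ⟨r, hr, hf⟩ := M.exists_finiteAt_lt hp
    refine lt_of_le_of_lt (lintegral_mono_ae ?_) (hf.1 i)
    filter_upwards [M.ae_levy_pos i] with y hy
    refine ENNReal.ofReal_le_ofReal ?_
    have h1 : Real.exp (-p * y) ≤ Real.exp (-r * y) := Real.exp_le_exp.mpr (by nlinarith)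
    have h2 : 1 ≤ Real.exp (-p * y) := Real.one_le_exp (by nlinarith)
    rw [Real.norm_eq_abs, abs_of_nonpos (by linarith)]
    linarith

theorem integrable_jump (hp : M.lowerExponent < (p : EReal)) {i j : Fin K} (hij : M.rate i j ≠ 0) :
    Integrable (fun y => Real.exp (-p * y)) (M.jump i j) := by
  have := M.jump_prob i j
  -- On the diagonal the rate is nonpositive and `ENNReal.ofReal` sends it to 0, so `FiniteAt`
  -- carries no information there; the jump law is a Dirac mass instead.
  by_cases e : i = j
  · subst e
    rw [M.jump_self]
    exact integrable_dirac (by simp)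
  have hpos : 0 < M.rate i j := lt_of_le_of_ne (M.rate_nonneg i j e) hij.symm
  obtain ⟨r, hr, hf⟩ := M.exists_finiteAt_lt hp
  refine ⟨by fun_prop, ?_⟩
  rw [hasFiniteIntegral_iff_norm]
  have hfin : ∫⁻ y, ENNReal.ofReal (Real.exp (-r * y)) ∂(M.jump i j) < ⊤ := by
    have h := hf.2 i j
    by_contra hc
    rw [not_lt, top_le_iff] at hc
    rw [hc, ENNReal.mul_top (by simpa using hpos)] at h
    exact lt_irrefl _ h
  refine lt_of_le_of_lt (lintegral_mono_ae ?_) hfin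
  filter_upwards [M.ae_jump_nonneg i j] with y hy
  refine ENNReal.ofReal_le_ofReal ?_
  rw [Real.norm_eq_abs, Real.abs_exp]
  exact Real.exp_le_exp.mpr (by nlinarith)

theorem generator_truncExp {ε : ℝ} (v : Fin K → ℝ) (i : Fin K) (x : ℝ) :
    M.generator (fun j x => v j * truncExp p ε x) i x =
      M.drift i * (v i * deriv (truncExp p ε) x) +
      v i * ∫ y, (truncExp p ε (x + y) - truncExp p ε x) ∂(M.levy i) +
      ∑ j, M.rate i j * ∫ y, (v j * truncExp p ε (x + y) - v i * truncExp p ε x) ∂(M.jump i j) -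
      M.kill i * (v i * truncExp p ε x) := by
  unfold generator
  simp only [← mul_sub, integral_const_mul, deriv_const_mul_field]

theorem norm_jump_integrand_le {ε : ℝ} (hε : 0 < ε) (a b x y : ℝ) :
    ‖a * truncExp p ε (x + y) - b * truncExp p ε x‖ ≤
      (|a| * (2 + Real.exp (-p * y)) + |b|) * truncExp p ε x := by
  have hx := truncExp_pos (p := p) hε x
  have hxy := truncExp_pos (p := p) hε (x + y)
  rw [Real.norm_eq_abs]
  refine (abs_sub _ _).trans ?_
  rw [abs_mul, abs_mul, abs_of_pos hx, abs_of_pos hxy, add_mul, mul_assoc]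
  gcongr
  exact truncExp_add_le hε x y

/-- Each part of the generator changes `truncExp` by at most a constant multiple of itself, by the
relative bounds above. This is the input for Gronwall, with a rate that survives ε → 0. -/
theorem exists_generator_bound (hp : M.lowerExponent < (p : EReal)) (v : Fin K → ℝ) :
    ∃ C, 0 ≤ C ∧ ∀ ε, 0 < ε → ∀ i x,
      |M.generator (fun j x => v j * truncExp p ε x) i x| ≤ C * truncExp p ε x := by
  set D : Fin K → ℝ := fun i => M.drift i * (|v i| * |p|) +
    |v i| * ∫ y, |1 - Real.exp (-p * y)| ∂(M.levy i) +
    ∑ j, |M.rate i j| * ∫ y, (|v j| * (2 + Real.exp (-p * y)) + |v i|) ∂(M.jump i j) +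
    M.kill i * |v i| with hD
  have hD0 : ∀ i, 0 ≤ D i := fun i => by
    have h1 := M.drift_nonneg i
    have h2 := M.kill_nonneg i
    have h3 : 0 ≤ ∫ y, |1 - Real.exp (-p * y)| ∂(M.levy i) := integral_nonneg fun _ => abs_nonneg _
    have h4 : 0 ≤ ∑ j, |M.rate i j| * ∫ y, (|v j| * (2 + Real.exp (-p * y)) + |v i|) ∂(M.jump i j) :=
      Finset.sum_nonneg fun j _ => mul_nonneg (abs_nonneg _) (integral_nonneg fun y => by positivity)
    rw [hD]; positivity
  refine ⟨∑ i, D i, Finset.sum_nonneg fun i _ => hD0 i, fun ε hε i x => ?_⟩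
  have hx := truncExp_pos (p := p) hε x
  refine le_trans ?_ (mul_le_mul_of_nonneg_right
    (Finset.single_le_sum (fun i _ => hD0 i) (Finset.mem_univ i)) hx.le)
  rw [generator_truncExp]
  have h1 : |M.drift i * (v i * deriv (truncExp p ε) x)| ≤
      M.drift i * (|v i| * |p|) * truncExp p ε x := by
    rw [abs_mul, abs_mul, abs_of_nonneg (M.drift_nonneg i), mul_assoc, mul_assoc]
    have := abs_deriv_truncExp_le (p := p) hε x
    have := M.drift_nonneg i
    gcongr
  have h2 : |v i * ∫ y, (truncExp p ε (x + y) - truncExp p ε x) ∂(M.levy i)| ≤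
      |v i| * (∫ y, |1 - Real.exp (-p * y)| ∂(M.levy i)) * truncExp p ε x := by
    rw [abs_mul, mul_assoc, ← integral_mul_const]
    gcongr
    exact norm_integral_le_of_norm_le (f := fun y => truncExp p ε (x + y) - truncExp p ε x)
      ((M.integrable_levy hp i).abs.mul_const _) (ae_of_all _ fun y => abs_truncExp_sub_le hε x y)
  have h3 : |∑ j, M.rate i j *
        ∫ y, (v j * truncExp p ε (x + y) - v i * truncExp p ε x) ∂(M.jump i j)| ≤
      (∑ j, |M.rate i j| * ∫ y, (|v j| * (2 + Real.exp (-p * y)) + |v i|) ∂(M.jump i j)) *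
        truncExp p ε x := by
    rw [Finset.sum_mul]
    refine (Finset.abs_sum_le_sum_abs _ _).trans (Finset.sum_le_sum fun j _ => ?_)
    -- When the rate vanishes, the jump law may have no exponential moment; the term is 0
    -- regardless.
    by_cases hr : M.rate i j = 0
    · simp [hr]
    have := M.jump_prob i j
    have hi := M.integrable_jump hp hr
    rw [abs_mul, mul_assoc, ← integral_mul_const]
    gcongr
    exact norm_integral_le_of_norm_le
      (f := fun y => v j * truncExp p ε (x + y) - v i * truncExp p ε x)
      (by fun_prop) (ae_of_all _ fun y => norm_jump_integrand_le hε _ _ _ _)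
  have h4 : |M.kill i * (v i * truncExp p ε x)| ≤ M.kill i * |v i| * truncExp p ε x := by
    rw [abs_mul, abs_mul, abs_of_nonneg (M.kill_nonneg i), abs_of_pos hx, mul_assoc]
  have t1 := abs_sub (M.drift i * (v i * deriv (truncExp p ε) x) +
      v i * (∫ y, (truncExp p ε (x + y) - truncExp p ε x) ∂(M.levy i)) +
      ∑ j, M.rate i j * ∫ y, (v j * truncExp p ε (x + y) - v i * truncExp p ε x) ∂(M.jump i j))
      (M.kill i * (v i * truncExp p ε x))
  have t2 := abs_add_three (M.drift i * (v i * deriv (truncExp p ε) x))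
      (v i * (∫ y, (truncExp p ε (x + y) - truncExp p ε x) ∂(M.levy i)))
      (∑ j, M.rate i j * ∫ y, (v j * truncExp p ε (x + y) - v i * truncExp p ε x) ∂(M.jump i j))
  rw [hD]
  linarith

theorem continuous_generator_truncExp (hp : M.lowerExponent < (p : EReal)) (v : Fin K → ℝ)
    {ε : ℝ} (hε : 0 < ε) (i : Fin K) :
    Continuous (M.generator (fun j x => v j * truncExp p ε x) i) := by
  have hc := continuous_truncExp (p := p) hε
  have hfun : M.generator (fun j x => v j * truncExp p ε x) i = fun x => _ :=
    funext fun x => M.generator_truncExp v i x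
  rw [hfun]
  have h1 : Continuous (deriv (truncExp p ε)) := (contDiff_truncExp hε).continuous_deriv le_rfl
  have h2 : Continuous fun x => ∫ y, (truncExp p ε (x + y) - truncExp p ε x) ∂(M.levy i) := by
    refine continuous_of_dominated (bound := fun y => |1 - Real.exp (-p * y)| * ε⁻¹)
      (fun x => by fun_prop) (fun x => ae_of_all _ fun y => ?_)
      ((M.integrable_levy hp i).abs.mul_const _) (ae_of_all _ fun y => by fun_prop)
    refine (abs_truncExp_sub_le hε x y).trans ?_
    gcongr
    exact truncExp_le_inv hε x
  have h3 : ∀ j, Continuous fun x => M.rate i j *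
      ∫ y, (v j * truncExp p ε (x + y) - v i * truncExp p ε x) ∂(M.jump i j) := fun j => by
    by_cases hr : M.rate i j = 0
    · simpa [hr] using continuous_const
    have := M.jump_prob i j
    have hi := M.integrable_jump hp hr
    refine continuous_const.mul (continuous_of_dominated
      (bound := fun y => (|v j| * (2 + Real.exp (-p * y)) + |v i|) * ε⁻¹)
      (fun x => by fun_prop) (fun x => ae_of_all _ fun y => ?_)
      (by fun_prop) (ae_of_all _ fun y => by fun_prop))
    refine (norm_jump_integrand_le hε _ _ x y).trans ?_
    gcongr
    exact truncExp_le_inv hε x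
  fun_prop

theorem bernstein_mulVec (v : Fin K → ℝ) (i : Fin K) :
    (M.bernstein p).mulVec v i = M.laplaceExponent i p * v i -
      ∑ j, M.rate i j * (∫ y, Real.exp (-p * y) ∂(M.jump i j)) * v j := by
  rw [bernstein, Matrix.sub_mulVec, Pi.sub_apply, Matrix.mulVec_diagonal]
  simp [Matrix.mulVec, dotProduct, jumpLaplace]

theorem tendsto_generator_truncExp (hp : M.lowerExponent < (p : EReal)) (v : Fin K → ℝ)
    (i : Fin K) (x : ℝ) :
    Tendsto (fun ε => M.generator (fun j x => v j * truncExp p ε x) i x) (𝓝[>] 0)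
      (𝓝 (-((M.bernstein p).mulVec v i * Real.exp (-p * x)))) := by
  have hx := tendsto_truncExp p x
  have hle : ∀ᶠ ε : ℝ in 𝓝[>] 0, 0 < ε := self_mem_nhdsWithin
  have h2 : Tendsto (fun ε => ∫ y, (truncExp p ε (x + y) - truncExp p ε x) ∂(M.levy i)) (𝓝[>] 0)
      (𝓝 (∫ y, (Real.exp (-p * (x + y)) - Real.exp (-p * x)) ∂(M.levy i))) := by
    refine tendsto_integral_filter_of_dominated_convergence
      (fun y => |1 - Real.exp (-p * y)| * Real.exp (-p * x)) ?_ ?_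
      ((M.integrable_levy hp i).abs.mul_const _)
      (ae_of_all _ fun y => (tendsto_truncExp p _).sub hx)
    · filter_upwards [hle] with ε hε
      have := continuous_truncExp (p := p) hε
      fun_prop
    · filter_upwards [hle] with ε hε
      refine ae_of_all _ fun y => (abs_truncExp_sub_le hε x y).trans ?_
      gcongr
      exact truncExp_le_exp hε x
  have h3 : ∀ j, Tendsto (fun ε => M.rate i j *
      ∫ y, (v j * truncExp p ε (x + y) - v i * truncExp p ε x) ∂(M.jump i j)) (𝓝[>] 0)
      (𝓝 (M.rate i j *
        ∫ y, (v j * Real.exp (-p * (x + y)) - v i * Real.exp (-p * x)) ∂(M.jump i j))) := fun j => by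
    by_cases hr : M.rate i j = 0
    · simp [hr]
    have := M.jump_prob i j
    have hi := M.integrable_jump hp hr
    refine (tendsto_integral_filter_of_dominated_convergence
      (fun y => (|v j| * (2 + Real.exp (-p * y)) + |v i|) * Real.exp (-p * x)) ?_ ?_
      (by fun_prop)
      (ae_of_all _ fun y => ((tendsto_truncExp p _).const_mul _).sub (hx.const_mul _))).const_mul _
    · filter_upwards [hle] with ε hε
      have := continuous_truncExp (p := p) hε
      fun_prop
    · filter_upwards [hle] with ε hε
      refine ae_of_all _ fun y => (norm_jump_integrand_le hε _ _ x y).trans ?_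
      gcongr
      exact truncExp_le_exp hε x
  have h := (((((tendsto_deriv_truncExp p x).const_mul (v i)).const_mul (M.drift i)).add
    (h2.const_mul (v i))).add (tendsto_finsetSum Finset.univ fun j _ => h3 j)).sub
    ((hx.const_mul (v i)).const_mul (M.kill i))
  simp only [← generator_truncExp] at h
  convert h using 2
  rw [bernstein_mulVec, laplaceExponent]
  have e1 : ∫ y, (Real.exp (-p * (x + y)) - Real.exp (-p * x)) ∂(M.levy i) =
      -((∫ y, (1 - Real.exp (-p * y)) ∂(M.levy i)) * Real.exp (-p * x)) := by
    rw [← integral_mul_const, ← integral_neg]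
    congr with y
    rw [mul_add, Real.exp_add]; ring
  have e2 : ∀ j, M.rate i j *
      ∫ y, (v j * Real.exp (-p * (x + y)) - v i * Real.exp (-p * x)) ∂(M.jump i j) =
      M.rate i j * (∫ y, Real.exp (-p * y) ∂(M.jump i j)) * v j * Real.exp (-p * x) -
        M.rate i j * (v i * Real.exp (-p * x)) := fun j => by
    by_cases hr : M.rate i j = 0
    · simp [hr]
    have := M.jump_prob i j
    have hi := M.integrable_jump hp hr
    have : (fun y => v j * Real.exp (-p * (x + y)) - v i * Real.exp (-p * x)) =
        fun y => (v j * Real.exp (-p * x)) * Real.exp (-p * y) - v i * Real.exp (-p * x) := by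
      ext y; rw [mul_add, Real.exp_add]; ring
    rw [this, integral_sub (by fun_prop) (by fun_prop), integral_const_mul]
    simp
    ring
  -- The terms -λ_{i,j} v_i exp(-p x) cancel when summed over `j`, because the rows of the rate
  -- matrix sum to 0.
  rw [e1, Finset.sum_congr rfl fun j _ => e2 j, Finset.sum_sub_distrib, ← Finset.sum_mul,
    ← Finset.sum_mul, M.rate_sum]
  ring

end Params

/-! ### Functions of position and type along the process -/

section Extend

variable {K : ℕ}

@[simp] theorem extend_succ (f : Fin K → ℝ → ℝ) (x : EReal) (i : Fin K) :
    extend f x i.succ = f i x.toReal := rfl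

@[simp] theorem extend_zero (f : Fin K → ℝ → ℝ) (x : EReal) : extend f x 0 = 0 := rfl

theorem abs_extend_le {f g : Fin K → ℝ → ℝ} (h : ∀ i x, |f i x| ≤ g i x) (x : EReal)
    (j : Fin (K + 1)) : |extend f x j| ≤ extend g x j := by
  cases j using Fin.cases with
  | zero => simp
  | succ i => exact h i _

theorem abs_extend_le_const {f : Fin K → ℝ → ℝ} {C : ℝ} (hC : 0 ≤ C) (h : ∀ i x, |f i x| ≤ C)
    (x : EReal) (j : Fin (K + 1)) : |extend f x j| ≤ C := by
  cases j using Fin.cases with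
  | zero => simpa using hC
  | succ i => exact h i _

theorem tendsto_extend {ι : Type*} {l : Filter ι} {f : ι → Fin K → ℝ → ℝ} {g : Fin K → ℝ → ℝ}
    (h : ∀ i x, Tendsto (fun a => f a i x) l (𝓝 (g i x))) (x : EReal) (j : Fin (K + 1)) :
    Tendsto (fun a => extend (f a) x j) l (𝓝 (extend g x j)) := by
  cases j using Fin.cases with
  | zero => exact tendsto_const_nhds
  | succ i => exact h i _

theorem measurable_extend {f : Fin K → ℝ → ℝ} (hf : ∀ i, Measurable (f i)) :
    Measurable fun z : EReal × Fin (K + 1) => extend f z.1 z.2 := by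
  refine measurable_from_prod_countable_left fun j => ?_
  cases j using Fin.cases with
  | zero => simp
  | succ i => exact (hf i).comp measurable_ereal_toReal

end Extend

/-! ### Right-continuous functions and means at a fixed time -/

/-- The function is the pointwise limit of its values at the next point of the grid of mesh 1/(n+1)
to the right of `t`, and these are step functions. -/
theorem measurable_of_rightCts {f : ℝ → ℝ} (hf : ∀ t, ContinuousWithinAt f (Ici t) t) :
    Measurable f := by
  have hlim : ∀ t : ℝ, Tendsto (fun n : ℕ => ((⌊t * (n + 1)⌋ : ℝ) + 1) / (n + 1)) atTop
      (𝓝[≥] t) := fun t => by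
    have hb : ∀ n : ℕ, t ≤ ((⌊t * (n + 1)⌋ : ℝ) + 1) / (n + 1) ∧
        ((⌊t * (n + 1)⌋ : ℝ) + 1) / (n + 1) ≤ t + 1 / ((n : ℝ) + 1) := fun n => by
      have h1 := Int.lt_floor_add_one (t * ((n : ℝ) + 1))
      have h2 := Int.floor_le (t * ((n : ℝ) + 1))
      constructor
      · rw [le_div_iff₀ (by positivity)]; exact h1.le
      · rw [div_le_iff₀ (by positivity)]; field_simp; linarith
    refine tendsto_nhdsWithin_iff.mpr ⟨?_, Eventually.of_forall fun n => (hb n).1⟩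
    refine tendsto_of_tendsto_of_tendsto_of_le_of_le tendsto_const_nhds ?_ (fun n => (hb n).1)
      fun n => (hb n).2
    simpa using tendsto_one_div_add_atTop_nhds_zero_nat.const_add t
  refine measurable_of_tendsto_metrizable (f := fun (n : ℕ) (t : ℝ) =>
    f (((⌊t * (n + 1)⌋ : ℝ) + 1) / (n + 1))) (fun n => ?_)
    (tendsto_pi_nhds.mpr fun t => (hf t).tendsto.comp (hlim t))
  exact (measurable_from_top (f := fun k : ℤ => f (((k : ℝ) + 1) / (n + 1)))).comp
    (Int.measurable_floor.comp (by fun_prop))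

theorem continuous_and_hasDerivWithinAt_of_integral {w : ℝ → ℝ}
    (hw : ∀ a b, IntervalIntegrable w volume a b) (hm : Measurable w) (c : ℝ) :
    (Continuous fun t => c + ∫ s in (0 : ℝ)..t, w s) ∧
    ∀ t, ContinuousWithinAt w (Ici t) t →
      HasDerivWithinAt (fun t => c + ∫ s in (0 : ℝ)..t, w s) (w t) (Ici t) t := by
  refine ⟨continuous_const.add (intervalIntegral.continuous_primitive hw 0), fun t ht => ?_⟩
  exact (intervalIntegral.integral_hasDerivWithinAt_right (hw 0 t)
    (hm.stronglyMeasurable.stronglyMeasurableAtFilter (l := 𝓝[>] t))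
    (ht.mono Ioi_subset_Ici_self)).const_add c

/-- The mean of a function of position and type at a fixed time. -/
noncomputable def meanAt {Ω : Type*} [MeasurableSpace Ω] {K : ℕ} (μ : Measure Ω)
    (ξ : ℝ≥0 → Ω → EReal) (J : ℝ≥0 → Ω → Fin (K + 1)) (h : Fin K → ℝ → ℝ) (t : ℝ) : ℝ :=
  ∫ ω, extend h (ξ t.toNNReal ω) (J t.toNNReal ω) ∂μ

namespace IsMarkovAdditive

variable {Ω : Type*} [MeasurableSpace Ω] {K : ℕ} {P : Fin K → Measure Ω}
  {ξ : ℝ≥0 → Ω → EReal} {J : ℝ≥0 → Ω → Fin (K + 1)}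

theorem measurable_extend (hM : IsMarkovAdditive P ξ J) {h : Fin K → ℝ → ℝ}
    (hh : ∀ i, Measurable (h i)) (t : ℝ≥0) : Measurable fun ω => extend h (ξ t ω) (J t ω) :=
  (MAP.measurable_extend hh).comp ((hM.measurable_position t).prodMk (hM.measurable_type t))

theorem type_eq_zero_of_le (hM : IsMarkovAdditive P ξ J) {s t : ℝ≥0} {ω : Ω} (hst : s ≤ t)
    (hs : J s ω = 0) : J t ω = 0 := by
  rw [hM.type_eq_zero_iff] at hs ⊢
  exact hM.absorbing s t ω hst hs

theorem eventually_type_eq (hM : IsMarkovAdditive P ξ J) (ω : Ω) (t : ℝ≥0) :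
    ∀ᶠ s in 𝓝[≥] t, J s ω = J t ω :=
  (hM.type_rightCts ω t).eventually ((isOpen_discrete {J t ω}).mem_nhds rfl)

/-- Types are discrete, so the type is constant just after `t`. If the process is alive at `t`, the
position is finite there and `EReal.toReal` is continuous; if it is dead, the function is 0. -/
theorem rightCts_extend (hM : IsMarkovAdditive P ξ J) {h : Fin K → ℝ → ℝ}
    (hh : ∀ i, Continuous (h i)) (ω : Ω) (t : ℝ≥0) :
    ContinuousWithinAt (fun s => extend h (ξ s ω) (J s ω)) (Ici t) t := by
  suffices hc : ContinuousWithinAt (fun s => extend h (ξ s ω) (J t ω)) (Ici t) t by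
    refine hc.congr_of_eventuallyEq ?_ rfl
    filter_upwards [hM.eventually_type_eq ω t] with s hs
    rw [hs]
  rcases Fin.eq_zero_or_eq_succ (J t ω) with h0 | ⟨i, hi⟩
  · simpa [h0] using continuousWithinAt_const
  · have htop : ξ t ω ≠ ⊤ := fun hx => by
      rw [← hM.type_eq_zero_iff, hi] at hx
      exact Fin.succ_ne_zero i hx
    simp only [hi, extend_succ]
    exact ((hh i).tendsto _).comp
      ((EReal.tendsto_toReal htop (hM.position_ne_bot t ω)).comp (hM.position_rightCts ω t))

theorem integrable_extend_of_bounded (hM : IsMarkovAdditive P ξ J) {h : Fin K → ℝ → ℝ} {C : ℝ}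
    (hh : ∀ i, Measurable (h i)) (hC : 0 ≤ C) (hb : ∀ i x, |h i x| ≤ C) (i : Fin K) (t : ℝ≥0) :
    Integrable (fun ω => extend h (ξ t ω) (J t ω)) (P i) := by
  have := hM.isProbabilityMeasure i
  exact Integrable.of_bound (hM.measurable_extend hh t).aestronglyMeasurable C
    (ae_of_all _ fun ω => abs_extend_le_const hC hb _ _)

theorem abs_meanAt_le (hM : IsMarkovAdditive P ξ J) {h : Fin K → ℝ → ℝ} {C : ℝ}
    (hC : 0 ≤ C) (hb : ∀ i x, |h i x| ≤ C) (i : Fin K) (t : ℝ) :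
    |meanAt (P i) ξ J h t| ≤ C := by
  have := hM.isProbabilityMeasure i
  simpa [meanAt] using norm_integral_le_of_norm_le_const (μ := P i)
    (f := fun ω => extend h (ξ t.toNNReal ω) (J t.toNNReal ω)) (ae_of_all _ fun ω => abs_extend_le_const hC hb (ξ t.toNNReal ω) (J t.toNNReal ω))

theorem rightCts_meanAt (hM : IsMarkovAdditive P ξ J) {h : Fin K → ℝ → ℝ} {C : ℝ}
    (hh : ∀ i, Continuous (h i)) (hC : 0 ≤ C) (hb : ∀ i x, |h i x| ≤ C) (i : Fin K) (t : ℝ) :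
    ContinuousWithinAt (meanAt (P i) ξ J h) (Ici t) t := by
  have := hM.isProbabilityMeasure i
  refine continuousWithinAt_of_dominated (bound := fun _ => C)
    (Eventually.of_forall fun s =>
      (hM.measurable_extend (fun i => (hh i).measurable) _).aestronglyMeasurable)
    (Eventually.of_forall fun s => ae_of_all _ fun ω => abs_extend_le_const hC hb _ _)
    (integrable_const C) (ae_of_all _ fun ω => ?_)
  exact (hM.rightCts_extend hh ω t.toNNReal).comp (f := Real.toNNReal)
    continuous_real_toNNReal.continuousWithinAt (fun s hs => Real.toNNReal_mono hs)

theorem measurable_meanAt (hM : IsMarkovAdditive P ξ J) {h : Fin K → ℝ → ℝ} {C : ℝ}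
    (hh : ∀ i, Continuous (h i)) (hC : 0 ≤ C) (hb : ∀ i x, |h i x| ≤ C) (i : Fin K) :
    Measurable (meanAt (P i) ξ J h) :=
  measurable_of_rightCts (hM.rightCts_meanAt hh hC hb i)

theorem intervalIntegrable_meanAt (hM : IsMarkovAdditive P ξ J) {h : Fin K → ℝ → ℝ} {C : ℝ}
    (hh : ∀ i, Continuous (h i)) (hC : 0 ≤ C) (hb : ∀ i x, |h i x| ≤ C) (i : Fin K) (a b : ℝ) :
    IntervalIntegrable (meanAt (P i) ξ J h) volume a b := by
  refine (intervalIntegrable_const (c := C)).mono_fun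
    (hM.measurable_meanAt hh hC hb i).aestronglyMeasurable (ae_of_all _ fun t => ?_)
  exact (hM.abs_meanAt_le hC hb i t).trans (le_abs_self C)

theorem meanAt_start (hM : IsMarkovAdditive P ξ J) (h : Fin K → ℝ → ℝ) (i : Fin K) :
    meanAt (P i) ξ J h 0 = h i 0 := by
  have := hM.isProbabilityMeasure i
  unfold meanAt
  rw [integral_congr_ae (g := fun _ => h i 0)]
  · simp
  · filter_upwards [hM.start i] with ω hω
    simp [hω.1, hω.2]

end IsMarkovAdditive

/-! ### Exponential moments and the moment matrix -/

namespace IsNondecreasing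

variable {Ω : Type*} [MeasurableSpace Ω] {K : ℕ} {M : Params K} {P : Fin K → Measure Ω}
  {ξ : ℝ≥0 → Ω → EReal} {J : ℝ≥0 → Ω → Fin (K + 1)}

theorem meanAt_eq (hM : IsNondecreasing M P ξ J) {f : Fin K → ℝ → ℝ} (hf : IsTest f) (i : Fin K)
    {t : ℝ} (ht : 0 ≤ t) :
    meanAt (P i) ξ J f t = f i 0 + ∫ s in (0 : ℝ)..t, meanAt (P i) ξ J (M.generator f) s := by
  have := hM.dynkin f hf i t.toNNReal
  rwa [Real.coe_toNNReal t ht] at this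

theorem hasDerivWithinAt_meanAt (hM : IsNondecreasing M P ξ J) {f : Fin K → ℝ → ℝ}
    (hf : IsTest f) {C : ℝ} (hC : 0 ≤ C) (hg : ∀ i, Continuous (M.generator f i))
    (hb : ∀ i x, |M.generator f i x| ≤ C) (i : Fin K) :
    ContinuousOn (meanAt (P i) ξ J f) (Ici 0) ∧
    ∀ t, 0 ≤ t → HasDerivWithinAt (meanAt (P i) ξ J f)
      (meanAt (P i) ξ J (M.generator f) t) (Ici t) t := by
  have h := continuous_and_hasDerivWithinAt_of_integral
    (hM.intervalIntegrable_meanAt hg hC hb i) (hM.measurable_meanAt hg hC hb i) (f i 0)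
  refine ⟨h.1.continuousOn.congr fun t ht => hM.meanAt_eq hf i ht, fun t ht => ?_⟩
  exact (h.2 t (hM.rightCts_meanAt hg hC hb i t)).congr
    (fun s hs => hM.meanAt_eq hf i (ht.trans hs)) (hM.meanAt_eq hf i ht)

variable {p : ℝ}

/-- By Dynkin's formula the mean u satisfies |u'| ≤ C u and u(0) = 1 / (1 + ε) ≤ 1, so Gronwall
applies with the same `C` for every `ε`. -/
theorem exists_meanAt_truncExp_le (hM : IsNondecreasing M P ξ J)
    (hp : M.lowerExponent < (p : EReal)) :
    ∃ C : ℝ, ∀ ε, 0 < ε → ∀ i t, 0 ≤ t →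
      meanAt (P i) ξ J (fun _ x => truncExp p ε x) t ≤ Real.exp (C * t) := by
  obtain ⟨C, hC, hb⟩ := M.exists_generator_bound hp (fun _ => 1)
  refine ⟨C, fun ε hε i t ht => ?_⟩
  have hft := isTest_truncExp (p := p) hε (fun _ : Fin K => (1 : ℝ))
  have hg := M.continuous_generator_truncExp hp (fun _ => 1) hε
  have hb := hb ε hε
  simp only [one_mul] at hft hg hb
  have hb' : ∀ i x, |M.generator (fun _ x => truncExp p ε x) i x| ≤ C * ε⁻¹ := fun i x =>
    (hb i x).trans (mul_le_mul_of_nonneg_left (truncExp_le_inv hε x) hC)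
  obtain ⟨h1, h2⟩ := hM.hasDerivWithinAt_meanAt hft (by positivity) hg hb' i
  have hpos : ∀ t, 0 ≤ meanAt (P i) ξ J (fun _ x => truncExp p ε x) t := fun t =>
    integral_nonneg fun ω => (abs_nonneg _).trans (abs_extend_le (fun _ x =>
      (abs_of_pos (truncExp_pos hε x)).le) _ _)
  have hgr := norm_le_gronwallBound_of_norm_deriv_right_le (δ := 1) (K := C) (ε := 0)
    (h1.mono Icc_subset_Ici_self) (fun s hs => h2 s hs.1) (b := t) ?_ ?_ t ⟨ht, le_rfl⟩
  · rw [gronwallBound_ε0, one_mul, sub_zero, Real.norm_eq_abs] at hgr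
    exact (le_abs_self _).trans hgr
  · rw [hM.meanAt_start, Real.norm_eq_abs, abs_of_pos (truncExp_pos hε _)]
    simpa using truncExp_le_exp (p := p) hε 0
  · intro s _
    rw [add_zero, Real.norm_eq_abs, Real.norm_eq_abs, abs_of_nonneg (hpos s)]
    unfold meanAt
    rw [← integral_const_mul]
    refine norm_integral_le_of_norm_le (f := fun ω => extend _ (ξ s.toNNReal ω) (J s.toNNReal ω))
      (Integrable.const_mul ?_ C) (ae_of_all _ fun ω => ?_)
    · exact hM.integrable_extend_of_bounded (fun _ => (continuous_truncExp hε).measurable)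
        (inv_pos.mpr hε).le (fun _ x => by
          rw [abs_of_pos (truncExp_pos hε x)]; exact truncExp_le_inv hε x) i _
    · refine (abs_extend_le (g := fun _ x => C * truncExp p ε x) hb _ _).trans_eq ?_
      cases J s.toNNReal ω using Fin.cases <;> simp

/-- Fatou's lemma as ε → 0 in the previous bound. This is what makes exp(-p ξ_t) on survival
available as a dominating function. -/
theorem exists_lintegral_exp_le (hM : IsNondecreasing M P ξ J)
    (hp : M.lowerExponent < (p : EReal)) :
    ∃ C : ℝ, ∀ i (t : ℝ≥0),
      ∫⁻ ω, ENNReal.ofReal (extend (fun _ x => Real.exp (-p * x)) (ξ t ω) (J t ω)) ∂(P i) ≤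
        ENNReal.ofReal (Real.exp (C * t)) := by
  obtain ⟨C, hC⟩ := hM.exists_meanAt_truncExp_le hp
  refine ⟨C, fun i t => ?_⟩
  have hlim : ∀ ω, Tendsto (fun ε =>
      ENNReal.ofReal (extend (fun _ x => truncExp p ε x) (ξ t ω) (J t ω))) (𝓝[>] 0)
      (𝓝 (ENNReal.ofReal (extend (fun _ x => Real.exp (-p * x)) (ξ t ω) (J t ω)))) := fun ω =>
    (ENNReal.continuous_ofReal.tendsto _).comp
      (tendsto_extend (fun _ x => tendsto_truncExp p x) _ _)
  calc _ = ∫⁻ ω, liminf (fun ε => ENNReal.ofReal (extend (fun _ x => truncExp p ε x)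
          (ξ t ω) (J t ω))) (𝓝[>] 0) ∂(P i) := lintegral_congr fun ω => (hlim ω).liminf_eq.symm
    _ ≤ liminf (fun ε => ∫⁻ ω, ENNReal.ofReal (extend (fun _ x => truncExp p ε x)
          (ξ t ω) (J t ω)) ∂(P i)) (𝓝[>] 0) := by
      refine lintegral_liminf_le fun ε => (hM.measurable_extend (fun _ => ?_) t).ennreal_ofReal
      unfold truncExp
      fun_prop
    _ ≤ _ := by
      refine liminf_le_of_frequently_le' (Eventually.frequently ?_)
      filter_upwards [self_mem_nhdsWithin] with ε hε
      rw [← ofReal_integral_eq_lintegral_ofReal]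
      · refine ENNReal.ofReal_le_ofReal ?_
        simpa [meanAt] using hC ε hε i t t.2
      · exact hM.integrable_extend_of_bounded (fun _ => (continuous_truncExp hε).measurable)
          (inv_pos.mpr hε).le (fun _ x => by
            rw [abs_of_pos (truncExp_pos hε x)]; exact truncExp_le_inv hε x) i _
      · exact ae_of_all _ fun ω => (abs_nonneg _).trans (abs_extend_le (fun _ x =>
          (abs_of_pos (truncExp_pos hε x)).le) _ _)

theorem integrable_extend_exp (hM : IsNondecreasing M P ξ J)
    (hp : M.lowerExponent < (p : EReal)) (v : Fin K → ℝ) (i : Fin K) (t : ℝ≥0) :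
    Integrable (fun ω => extend (fun j x => v j * Real.exp (-p * x)) (ξ t ω) (J t ω)) (P i) := by
  obtain ⟨C, hC⟩ := hM.exists_lintegral_exp_le hp
  have h1 : Integrable (fun ω => extend (fun _ x => Real.exp (-p * x)) (ξ t ω) (J t ω)) (P i) := by
    refine ⟨(hM.measurable_extend (fun _ => by fun_prop) t).aestronglyMeasurable, ?_⟩
    rw [hasFiniteIntegral_iff_ofReal]
    · exact (hC i t).trans_lt ENNReal.ofReal_lt_top
    · exact ae_of_all _ fun ω => (abs_nonneg _).trans (abs_extend_le (fun _ x =>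
          (abs_of_pos (Real.exp_pos _)).le) _ _)
  refine (h1.const_mul (∑ j, |v j|)).mono'
    (hM.measurable_extend (fun _ => by fun_prop) t).aestronglyMeasurable (ae_of_all _ fun ω => ?_)
  cases J t ω using Fin.cases with
  | zero => simp
  | succ j =>
    rw [extend_succ, extend_succ, norm_mul, Real.norm_eq_abs, Real.norm_eq_abs, Real.abs_exp]
    gcongr
    exact Finset.single_le_sum (f := fun j => |v j|) (fun _ _ => abs_nonneg _) (Finset.mem_univ j)

theorem exists_meanAt_exp_le (hM : IsNondecreasing M P ξ J)
    (hp : M.lowerExponent < (p : EReal)) :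
    ∃ C : ℝ, ∀ i t, 0 ≤ t → meanAt (P i) ξ J (fun _ x => Real.exp (-p * x)) t ≤
      Real.exp (C * t) := by
  obtain ⟨C, hC⟩ := hM.exists_lintegral_exp_le hp
  refine ⟨C, fun i t ht => ?_⟩
  have h := hC i t.toNNReal
  have hi := hM.integrable_extend_exp hp (fun _ => 1) i t.toNNReal
  simp only [one_mul] at hi
  rw [← ofReal_integral_eq_lintegral_ofReal hi (ae_of_all _ fun ω => (abs_nonneg _).trans
    (abs_extend_le (fun _ x => (abs_of_pos (Real.exp_pos _)).le) _ _)),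
    ENNReal.ofReal_le_ofReal_iff (Real.exp_pos _).le, Real.coe_toNNReal t ht] at h
  exact h

theorem tendsto_meanAt (hM : IsNondecreasing M P ξ J)
    (hp : M.lowerExponent < (p : EReal)) {f : ℝ → Fin K → ℝ → ℝ} {v : Fin K → ℝ} {C : ℝ}
    (hf : ∀ ε, 0 < ε → ∀ i, Measurable (f ε i))
    (hb : ∀ ε, 0 < ε → ∀ i x, |f ε i x| ≤ C * truncExp p ε x) (hC : 0 ≤ C)
    (hl : ∀ i x, Tendsto (fun ε => f ε i x) (𝓝[>] 0) (𝓝 (v i * Real.exp (-p * x))))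
    (i : Fin K) (t : ℝ) :
    Tendsto (fun ε => meanAt (P i) ξ J (f ε) t) (𝓝[>] 0)
      (𝓝 (meanAt (P i) ξ J (fun j x => v j * Real.exp (-p * x)) t)) := by
  refine tendsto_integral_filter_of_dominated_convergence _ ?_ ?_
    (hM.integrable_extend_exp hp (fun _ => C) i t.toNNReal)
    (ae_of_all _ fun ω => tendsto_extend hl _ _)
  · filter_upwards [self_mem_nhdsWithin] with ε hε
    exact (hM.measurable_extend (hf ε hε) _).aestronglyMeasurable
  · filter_upwards [self_mem_nhdsWithin] with ε hε
    refine ae_of_all _ fun ω => abs_extend_le (fun j x => (hb ε hε j x).trans ?_) _ _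
    exact mul_le_mul_of_nonneg_left (truncExp_le_exp hε x) hC

theorem abs_mul_truncExp_le {ε : ℝ} (hε : 0 < ε) (v : Fin K → ℝ) (i : Fin K) (x : ℝ) :
    |v i * truncExp p ε x| ≤ (∑ j, |v j|) * truncExp p ε x := by
  rw [abs_mul, abs_of_pos (truncExp_pos hε x)]
  exact mul_le_mul_of_nonneg_right (Finset.single_le_sum (f := fun j => |v j|)
    (fun _ _ => abs_nonneg _) (Finset.mem_univ i)) (truncExp_pos hε x).le

/-- The right-continuity argument needs bounded functions; the exponential is reached as a limit of
truncations along ε = 1/(n+1). -/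
theorem measurable_meanAt_exp (hM : IsNondecreasing M P ξ J)
    (hp : M.lowerExponent < (p : EReal)) (v : Fin K → ℝ) (i : Fin K) :
    Measurable (meanAt (P i) ξ J (fun j x => v j * Real.exp (-p * x))) := by
  have hseq : Tendsto (fun n : ℕ => 1 / ((n : ℝ) + 1)) atTop (𝓝[>] 0) :=
    tendsto_nhdsWithin_iff.mpr ⟨tendsto_one_div_add_atTop_nhds_zero_nat,
      Eventually.of_forall fun n => by simp only [mem_Ioi]; positivity⟩
  have hS : 0 ≤ ∑ j, |v j| := Finset.sum_nonneg fun _ _ => abs_nonneg _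
  refine measurable_of_tendsto_metrizable (f := fun n : ℕ =>
    meanAt (P i) ξ J (fun j x => v j * truncExp p (1 / ((n : ℝ) + 1)) x)) (fun n => ?_)
    (tendsto_pi_nhds.mpr fun t => (hM.tendsto_meanAt hp (C := ∑ j, |v j|)
      (f := fun ε j x => v j * truncExp p ε x)
      (fun ε hε j => ((continuous_truncExp hε).measurable.const_mul _))
      (fun ε hε j x => abs_mul_truncExp_le hε v j x) hS
      (fun j x => (tendsto_truncExp p x).const_mul _) i t).comp hseq)
  have hn : 0 < 1 / ((n : ℝ) + 1) := by positivity
  exact hM.measurable_meanAt (fun j => continuous_const.mul (continuous_truncExp hn))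
    (C := (∑ j, |v j|) * (1 / ((n : ℝ) + 1))⁻¹) (by positivity)
    (fun j x => (abs_mul_truncExp_le hn v j x).trans
      (mul_le_mul_of_nonneg_left (truncExp_le_inv hn x) hS)) i

theorem exists_abs_meanAt_exp_le (hM : IsNondecreasing M P ξ J)
    (hp : M.lowerExponent < (p : EReal)) (i : Fin K) :
    ∃ C : ℝ, ∀ {h : Fin K → ℝ → ℝ} {D : ℝ}, (∀ j x, |h j x| ≤ D * Real.exp (-p * x)) → 0 ≤ D →
      ∀ t, 0 ≤ t → |meanAt (P i) ξ J h t| ≤ D * Real.exp (C * t) := by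
  obtain ⟨C, hC⟩ := hM.exists_meanAt_exp_le hp
  refine ⟨C, fun {h D} hb hD t ht => ?_⟩
  have h1 : |meanAt (P i) ξ J h t| ≤ meanAt (P i) ξ J (fun _ x => D * Real.exp (-p * x)) t :=
    norm_integral_le_of_norm_le (f := fun ω => extend h (ξ t.toNNReal ω) (J t.toNNReal ω))
      (hM.integrable_extend_exp hp (fun _ => D) i t.toNNReal)
      (ae_of_all _ fun ω => abs_extend_le hb _ _)
  have h2 : meanAt (P i) ξ J (fun _ x => D * Real.exp (-p * x)) t =
      D * meanAt (P i) ξ J (fun _ x => Real.exp (-p * x)) t := by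
    unfold meanAt
    rw [← integral_const_mul]
    congr with ω
    cases J t.toNNReal ω using Fin.cases <;> simp
  rw [h2] at h1
  exact h1.trans (mul_le_mul_of_nonneg_left (hC i t ht) hD)

theorem intervalIntegrable_meanAt_exp (hM : IsNondecreasing M P ξ J)
    (hp : M.lowerExponent < (p : EReal)) (v : Fin K → ℝ) (i : Fin K) (a b : ℝ) :
    IntervalIntegrable (meanAt (P i) ξ J (fun j x => v j * Real.exp (-p * x))) volume a b := by
  obtain ⟨C, hC⟩ := hM.exists_abs_meanAt_exp_le hp i
  have hS : 0 ≤ ∑ j, |v j| := Finset.sum_nonneg fun _ _ => abs_nonneg _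
  -- `meanAt` reads time through `Real.toNNReal`, so the majorant does too; it is then valid on
  -- negative times as well.
  have hcont : Continuous fun t : ℝ => (∑ j, |v j|) * Real.exp (C * (t.toNNReal : ℝ)) := by
    fun_prop
  refine (hcont.intervalIntegrable a b).mono_fun
    (hM.measurable_meanAt_exp hp v i).aestronglyMeasurable (ae_of_all _ fun t => ?_)
  have h := hC (h := fun j x => v j * Real.exp (-p * x)) (D := ∑ j, |v j|) (fun j x => by
    rw [abs_mul, Real.abs_exp]
    exact mul_le_mul_of_nonneg_right (Finset.single_le_sum (f := fun j => |v j|)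
      (fun _ _ => abs_nonneg _) (Finset.mem_univ j)) (Real.exp_pos _).le) hS t.toNNReal t.toNNReal.2
  have e : meanAt (P i) ξ J (fun j x => v j * Real.exp (-p * x)) (t.toNNReal : ℝ) =
      meanAt (P i) ξ J (fun j x => v j * Real.exp (-p * x)) t := by
    unfold meanAt; rw [Real.toNNReal_coe]
  rw [e] at h
  exact h.trans (le_abs_self _)

/-- Dynkin's formula for v_j exp(-p x), as the limit ε → 0 of the formula for `truncExp`. The time
integral converges by domination by C exp(D s). -/
theorem meanAt_exp_eq (hM : IsNondecreasing M P ξ J)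
    (hp : M.lowerExponent < (p : EReal)) (v : Fin K → ℝ) (i : Fin K) {t : ℝ} (ht : 0 ≤ t) :
    meanAt (P i) ξ J (fun j x => v j * Real.exp (-p * x)) t =
      v i + ∫ s in (0 : ℝ)..t, meanAt (P i) ξ J
        (fun j x => -(M.bernstein p).mulVec v j * Real.exp (-p * x)) s := by
  have hS : 0 ≤ ∑ j, |v j| := Finset.sum_nonneg fun _ _ => abs_nonneg _
  obtain ⟨C, hC, hb⟩ := M.exists_generator_bound hp v
  obtain ⟨D, hD⟩ := hM.exists_abs_meanAt_exp_le hp i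
  have h1 := hM.tendsto_meanAt hp (C := ∑ j, |v j|)
    (f := fun ε j x => v j * truncExp p ε x)
    (fun ε hε j => ((continuous_truncExp hε).measurable.const_mul _))
    (fun ε hε j x => abs_mul_truncExp_le hε v j x) hS
    (fun j x => (tendsto_truncExp p x).const_mul _) i t
  have h2 : ∀ s, Tendsto (fun ε => meanAt (P i) ξ J
      (M.generator fun j x => v j * truncExp p ε x) s) (𝓝[>] 0)
      (𝓝 (meanAt (P i) ξ J (fun j x => -(M.bernstein p).mulVec v j * Real.exp (-p * x)) s)) :=
    fun s => hM.tendsto_meanAt hp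
      (f := fun ε => M.generator fun j x => v j * truncExp p ε x)
      (fun ε hε j => (M.continuous_generator_truncExp hp v hε j).measurable) hb hC
      (fun j x => by simpa only [neg_mul] using M.tendsto_generator_truncExp hp v j x) i s
  have h3 : Tendsto (fun ε => v i * truncExp p ε 0 + ∫ s in (0 : ℝ)..t, meanAt (P i) ξ J
      (M.generator fun j x => v j * truncExp p ε x) s) (𝓝[>] 0)
      (𝓝 (v i * Real.exp (-p * 0) + ∫ s in (0 : ℝ)..t, meanAt (P i) ξ J
        (fun j x => -(M.bernstein p).mulVec v j * Real.exp (-p * x)) s)) := by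
    refine ((tendsto_truncExp p 0).const_mul _).add
      (intervalIntegral.tendsto_integral_filter_of_dominated_convergence
        (fun s => C * Real.exp (D * s)) ?_ ?_
        (Continuous.intervalIntegrable (by fun_prop) _ _) (ae_of_all _ fun s _ => h2 s))
    · filter_upwards [self_mem_nhdsWithin] with ε hε
      exact (hM.measurable_meanAt (M.continuous_generator_truncExp hp v hε)
        (C := C * ε⁻¹) (mul_nonneg hC (inv_pos.mpr hε).le) (fun j x => (hb ε hε j x).trans
          (mul_le_mul_of_nonneg_left (truncExp_le_inv hε x) hC)) i).aestronglyMeasurable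
    · filter_upwards [self_mem_nhdsWithin] with ε hε
      refine ae_of_all _ fun s hs => ?_
      rw [uIoc_of_le ht] at hs
      exact hD (fun j x => (hb ε hε j x).trans
        (mul_le_mul_of_nonneg_left (truncExp_le_exp hε x) hC)) hC s hs.1.le
  rw [mul_zero, Real.exp_zero, mul_one] at h3
  refine tendsto_nhds_unique (h1.congr' ?_) h3
  filter_upwards [self_mem_nhdsWithin] with ε hε
  exact hM.meanAt_eq (isTest_truncExp hε v) i ht

/-- The matrix with entries `E_i[exp (-p ξ_t); J_t = j]`. -/
noncomputable def _root_.MAP.momentMatrix {Ω : Type*} [MeasurableSpace Ω] {K : ℕ}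
    (P : Fin K → Measure Ω) (ξ : ℝ≥0 → Ω → EReal) (J : ℝ≥0 → Ω → Fin (K + 1)) (p t : ℝ) :
    Matrix (Fin K) (Fin K) ℝ :=
  Matrix.of fun i j => meanAt (P i) ξ J (fun l x => (Pi.single j 1 : Fin K → ℝ) l *
    Real.exp (-p * x)) t

theorem meanAt_exp_eq_mulVec (hM : IsNondecreasing M P ξ J)
    (hp : M.lowerExponent < (p : EReal)) (v : Fin K → ℝ) (i : Fin K) (t : ℝ) :
    meanAt (P i) ξ J (fun j x => v j * Real.exp (-p * x)) t =
      (momentMatrix P ξ J p t).mulVec v i := by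
  simp only [momentMatrix, Matrix.mulVec, dotProduct, Matrix.of_apply, meanAt]
  simp only [← integral_mul_const]
  rw [← integral_finsetSum _ fun j _ => (hM.integrable_extend_exp hp _ i _).mul_const _]
  congr with ω
  cases J t.toNNReal ω using Fin.cases with
  | zero => simp
  | succ l => simp [Pi.single_apply, mul_comm]

open scoped Matrix.Norms.Operator in
-- With unit vectors for `v`, Dynkin's formula is the integral equation m(t) = 1 - ∫₀ᵗ m Φ. It first
-- yields continuity of m; the integrand is then continuous and m has the right derivative -m Φ.
theorem momentMatrix_eq_exp (hM : IsNondecreasing M P ξ J)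
    (hp : M.lowerExponent < (p : EReal)) {t : ℝ} (ht : 0 ≤ t) :
    momentMatrix P ξ J p t = NormedSpace.exp (-(t • M.bernstein p)) := by
  have key : ∀ i j, ContinuousOn (fun t => momentMatrix P ξ J p t i j) (Ici 0) ∧
      (ContinuousOn (fun t => momentMatrix P ξ J p t) (Ici 0) → ∀ t, 0 ≤ t →
        HasDerivWithinAt (fun t => momentMatrix P ξ J p t i j)
          ((-(momentMatrix P ξ J p t * M.bernstein p)) i j) (Ici t) t) := fun i j => by
    set w : Fin K → ℝ := fun l => -(M.bernstein p).mulVec (Pi.single j 1) l with hw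
    have h := continuous_and_hasDerivWithinAt_of_integral
      (hM.intervalIntegrable_meanAt_exp hp w i) (hM.measurable_meanAt_exp hp w i)
      ((Pi.single j 1 : Fin K → ℝ) i)
    have heq : ∀ t, 0 ≤ t → momentMatrix P ξ J p t i j = _ := fun t ht =>
      hM.meanAt_exp_eq hp (Pi.single j 1) i ht
    have hwm : ∀ t, (-(momentMatrix P ξ J p t * M.bernstein p)) i j =
        meanAt (P i) ξ J (fun l x => w l * Real.exp (-p * x)) t := fun t => by
      rw [hM.meanAt_exp_eq_mulVec hp]
      simp [hw, Matrix.mul_apply, Matrix.mulVec, dotProduct, Pi.single_apply]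
    refine ⟨h.1.continuousOn.congr heq, fun hc t ht => ?_⟩
    rw [hwm]
    refine (h.2 t ?_).congr (fun s hs => heq s (ht.trans hs)) (heq t ht)
    have hwm' : meanAt (P i) ξ J (fun l x => w l * Real.exp (-p * x)) =
        fun t => (-(momentMatrix P ξ J p t * M.bernstein p)) i j := funext fun t => (hwm t).symm
    rw [hwm']
    have hc' : ContinuousWithinAt (fun t => momentMatrix P ξ J p t) (Ici t) t :=
      (hc t ht).mono (Ici_subset_Ici.mpr ht)
    exact ((by fun_prop : Continuous fun A : Matrix (Fin K) (Fin K) ℝ =>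
      (-(A * M.bernstein p)) i j).tendsto _).comp hc'
  have hc : ContinuousOn (fun t => momentMatrix P ξ J p t) (Ici 0) :=
    continuousOn_pi.mpr fun i => continuousOn_pi.mpr fun j => (key i j).1
  refine eq_exp_of_hasDerivWithinAt ?_ hc (fun t ht => ?_) ht
  · ext i j
    simp [momentMatrix, hM.meanAt_start, Matrix.one_apply, Pi.single_apply]
  · exact hasDerivWithinAt_pi.mpr fun i => hasDerivWithinAt_pi.mpr fun j => (key i j).2 hc t ht

theorem momentMatrix_nsmul (hM : IsNondecreasing M P ξ J)
    (hp : M.lowerExponent < (p : EReal)) {t : ℝ} (ht : 0 ≤ t) (n : ℕ) :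
    momentMatrix P ξ J p (n * t) = NormedSpace.exp (-(t • M.bernstein p)) ^ n := by
  rw [hM.momentMatrix_eq_exp hp (by positivity), ← Matrix.exp_nsmul]
  congr 1
  rw [smul_neg, mul_smul, Nat.cast_smul_eq_nsmul]

end IsNondecreasing

/-! ### Positions before death -/

/-- The weight `exp (-p x)` of a position `x`, in `[0, ∞]`. -/
noncomputable def expWeight (p : ℝ) (x : EReal) : ℝ≥0∞ := EReal.exp (-(p : EReal) * x)

theorem continuous_expWeight (p : ℝ) : Continuous (expWeight p) := by
  -- Multiplication on `EReal` is discontinuous at (0, ±∞), hence the separate case.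
  rcases eq_or_ne p 0 with rfl | hp
  · unfold expWeight; simpa using continuous_const
  refine ENNReal.continuous_exp.comp (continuous_iff_continuousAt.mpr fun x => ?_)
  have h0 : (-(p : EReal)) ≠ 0 := by
    rw [← EReal.coe_neg]; exact_mod_cast neg_ne_zero.mpr hp
  have hb : (-(p : EReal)) ≠ ⊥ := by rw [← EReal.coe_neg]; exact EReal.coe_ne_bot _
  have ht : (-(p : EReal)) ≠ ⊤ := by rw [← EReal.coe_neg]; exact EReal.coe_ne_top _
  exact (EReal.continuousAt_mul (p := (-(p : EReal), x)) (Or.inl h0) (Or.inl h0) (Or.inl hb)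
    (Or.inl ht)).comp (by fun_prop : ContinuousAt (fun x : EReal => (-(p : EReal), x)) x)

theorem expWeight_mono {p : ℝ} (hp : p ≤ 0) : Monotone (expWeight p) := fun _ _ h =>
  EReal.exp_monotone (mul_le_mul_of_nonneg_left h (by
    rw [← EReal.coe_neg]; exact_mod_cast neg_nonneg.mpr hp))

theorem expWeight_anti {p : ℝ} (hp : 0 ≤ p) : Antitone (expWeight p) := fun x y h =>
  EReal.exp_monotone (by
    rw [EReal.neg_mul, EReal.neg_mul, EReal.neg_le_neg_iff]
    exact mul_le_mul_of_nonneg_left h (by exact_mod_cast hp))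

theorem expWeight_zero (p : ℝ) : expWeight p 0 = 1 := by simp [expWeight]

namespace IsMarkovAdditive

variable {Ω : Type*} [MeasurableSpace Ω] {K : ℕ} {P : Fin K → Measure Ω}
  {ξ : ℝ≥0 → Ω → EReal} {J : ℝ≥0 → Ω → Fin (K + 1)} {ω : Ω}

theorem ofReal_extend_exp (hM : IsMarkovAdditive P ξ J) (p : ℝ) {t : ℝ≥0} (h : J t ω ≠ 0) :
    ENNReal.ofReal (extend (fun _ x => Real.exp (-p * x)) (ξ t ω) (J t ω)) =
      expWeight p (ξ t ω) := by
  have htop : ξ t ω ≠ ⊤ := fun hx => h ((hM.type_eq_zero_iff t ω).mpr hx)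
  obtain ⟨i, hi⟩ := Fin.exists_succ_eq.mpr h
  rw [← hi, extend_succ, expWeight]
  conv_rhs => rw [← EReal.coe_toReal htop (hM.position_ne_bot t ω), ← EReal.coe_neg,
    ← EReal.coe_mul, EReal.exp_coe]

theorem exists_gt_type_ne_zero (hM : IsMarkovAdditive P ξ J) {t : ℝ≥0} (h : J t ω ≠ 0) :
    ∃ s, t < s ∧ J s ω ≠ 0 := by
  have h1 := (hM.eventually_type_eq ω t).filter_mono (nhdsWithin_mono t Ioi_subset_Ici_self)
  obtain ⟨s, hs1, hs2⟩ := (h1.and self_mem_nhdsWithin).exists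
  exact ⟨s, hs2, hs1 ▸ h⟩

theorem lt_of_type (hM : IsMarkovAdditive P ξ J) {s t : ℝ≥0} (hs : J s ω ≠ 0) (ht : J t ω = 0) :
    s < t :=
  lt_of_not_ge fun h => hs (hM.type_eq_zero_of_le h ht)

/-- By right-continuity a path alive at `t` stays alive a little longer, so its death time is
strictly larger than `t`. -/
theorem coe_lt_deathTime_iff (hM : IsMarkovAdditive P ξ J) {t : ℝ≥0} :
    (t : ℝ≥0∞) < deathTime ξ ω ↔ J t ω ≠ 0 := by
  constructor
  · intro h h0
    exact h.not_ge (sInf_le ⟨t, (hM.type_eq_zero_iff t ω).mp h0, rfl⟩)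
  · intro h
    obtain ⟨s, hts, hs⟩ := hM.exists_gt_type_ne_zero h
    refine (ENNReal.coe_lt_coe.mpr hts).trans_le (le_sInf ?_)
    rintro _ ⟨u, hu, rfl⟩
    exact ENNReal.coe_le_coe.mpr (hM.lt_of_type hs ((hM.type_eq_zero_iff u ω).mpr hu)).le

theorem le_deathPosition (hM : IsMarkovAdditive P ξ J) {t : ℝ≥0} (h : J t ω ≠ 0) :
    ξ t ω ≤ deathPosition ξ ω :=
  le_iSup₂ (f := fun (t : ℝ≥0) (_ : (t : ℝ≥0∞) < deathTime ξ ω) => ξ t ω) t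
    (hM.coe_lt_deathTime_iff.mpr h)

theorem exists_lt_of_lt_deathPosition (hM : IsMarkovAdditive P ξ J) {a : EReal}
    (h : a < deathPosition ξ ω) : ∃ t, J t ω ≠ 0 ∧ a < ξ t ω := by
  obtain ⟨t, ht⟩ := lt_iSup_iff.mp h
  obtain ⟨ht1, ht2⟩ := lt_iSup_iff.mp ht
  exact ⟨t, hM.coe_lt_deathTime_iff.mp ht1, ht2⟩

/-- The weight of the position at the time `n h`, on the event of death in `(n h, (n + 1) h]`. -/
noncomputable def _root_.MAP.gridTerm (ξ : ℝ≥0 → Ω → EReal) (J : ℝ≥0 → Ω → Fin (K + 1)) (p : ℝ)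
    (h : ℝ≥0) (n : ℕ) (ω : Ω) : ℝ≥0∞ :=
  {ω | J (n * h + h) ω = 0}.indicator (fun ω => ENNReal.ofReal
    (extend (fun _ x => Real.exp (-p * x)) (ξ (n * h) ω) (J (n * h) ω))) ω

theorem measurable_gridTerm (hM : IsMarkovAdditive P ξ J) (p : ℝ) (h : ℝ≥0) (n : ℕ) :
    Measurable (gridTerm ξ J p h n) :=
  (hM.measurable_extend (fun _ => by fun_prop) _).ennreal_ofReal.indicator
    (hM.measurable_type _ (measurableSet_singleton 0))

theorem tsum_gridTerm_eq_zero (p : ℝ) (h : ℝ≥0) (hω : ∀ t, J t ω ≠ 0) :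
    ∑' n, gridTerm ξ J p h n ω = 0 :=
  ENNReal.tsum_eq_zero.mpr fun n =>
    indicator_of_notMem (s := {ω | J (n * h + h) ω = 0}) (hω (n * h + h)) _

theorem exists_tsum_gridTerm_eq (hM : IsMarkovAdditive P ξ J) (p : ℝ) {h : ℝ≥0} (hh : 0 < h)
    (h0 : J 0 ω ≠ 0) (hω : ∃ t, J t ω = 0) :
    ∃ s, J s ω ≠ 0 ∧ J (s + h) ω = 0 ∧ ∑' n, gridTerm ξ J p h n ω = expWeight p (ξ s ω) := by
  classical
  have hex : ∃ n : ℕ, J (n * h) ω = 0 := by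
    obtain ⟨t, ht⟩ := hω
    obtain ⟨n, hn⟩ := exists_nat_ge (t / h)
    exact ⟨n, hM.type_eq_zero_of_le ((div_le_iff₀ hh).mp hn) ht⟩
  -- The first dead grid index is positive since the path starts alive; `N` is the last live one.
  obtain ⟨N, hN⟩ : ∃ N, Nat.find hex = N + 1 := Nat.exists_eq_succ_of_ne_zero fun h' => by
    have := Nat.find_spec hex
    rw [h'] at this
    exact h0 (by simpa using this)
  have hN1 : J ((N : ℝ≥0) * h) ω ≠ 0 := Nat.find_min hex (by omega)
  have hN2 : J ((N : ℝ≥0) * h + h) ω = 0 := by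
    have := Nat.find_spec hex
    rw [hN] at this
    simpa [add_mul] using this
  refine ⟨N * h, hN1, hN2, ?_⟩
  rw [tsum_eq_single N]
  · rw [gridTerm, indicator_of_mem (by exact hN2), hM.ofReal_extend_exp p hN1]
  · intro n hn
    rcases lt_or_gt_of_ne hn with hlt | hgt
    · refine indicator_of_notMem (s := {ω | J (n * h + h) ω = 0})
        (fun hd => hN1 (hM.type_eq_zero_of_le ?_ hd)) _
      have : ((n + 1 : ℕ) : ℝ≥0) * h ≤ N * h := by gcongr; omega
      simpa [add_mul] using this
    -- The indicator in `gridTerm` is 1 for all later indices too; those terms vanish because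
    -- `extend` is 0 at the cemetery.
    · have hd : J ((n : ℝ≥0) * h) ω = 0 := by
        refine hM.type_eq_zero_of_le ?_ hN2
        have : ((N + 1 : ℕ) : ℝ≥0) * h ≤ n * h := by gcongr; omega
        simpa [add_mul] using this
      simp [gridTerm, hd]

theorem past_le (hM : IsMarkovAdditive P ξ J) (t : ℝ≥0) : past ξ J t ≤ ‹MeasurableSpace Ω› :=
  iSup₂_le fun u _ => ((hM.measurable_position u).prodMk (hM.measurable_type u)).comap_le

theorem measurable_past_extend {f : Fin K → ℝ → ℝ} (hf : ∀ i, Measurable (f i)) (t : ℝ≥0) :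
    Measurable[past ξ J t] fun ω => extend f (ξ t ω) (J t ω) := by
  refine (MAP.measurable_extend hf).comp (Measurable.mono (comap_measurable
    (fun ω => (ξ t ω, J t ω))) ?_ le_rfl)
  exact le_iSup₂ (f := fun (u : ℝ≥0) (_ : u ∈ Iic t) =>
    MeasurableSpace.comap (fun ω => (ξ u ω, J u ω)) inferInstance) t self_mem_Iic

/-- The Markov property at `t` says that, on the past sigma-algebra, restricting to type `j` and
death by t + h is the same measure as restricting to type `j` and scaling by the death probability.
Integrals of past-measurable functions therefore agree. -/
theorem setLIntegral_type_death (hM : IsMarkovAdditive P ξ J) (i j : Fin K) (t h : ℝ≥0)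
    {f : Ω → ℝ≥0∞} (hf : Measurable[past ξ J t] f) :
    ∫⁻ ω in {ω | J t ω = j.succ} ∩ {ω | J (t + h) ω = 0}, f ω ∂(P i) =
      (∫⁻ ω in {ω | J t ω = j.succ}, f ω ∂(P i)) * P j {ω | J h ω = 0} := by
  have hm := hM.past_le t
  have hB : MeasurableSet {ω | J t ω = j.succ} :=
    hM.measurable_type t (measurableSet_singleton _)
  have hD : MeasurableSet {ω | J (t + h) ω = 0} :=
    hM.measurable_type _ (measurableSet_singleton _)
  rw [← lintegral_trim hm hf, ← lintegral_trim hm hf, mul_comm, ← smul_eq_mul,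
    ← lintegral_smul_measure]
  congr 1
  refine @Measure.ext _ (past ξ J t) _ _ fun A hA => ?_
  rw [Measure.smul_apply, trim_measurableSet_eq hm hA, trim_measurableSet_eq hm hA,
    Measure.restrict_apply (hm A hA), Measure.restrict_apply (hm A hA), smul_eq_mul, mul_comm,
    ← inter_assoc]
  have hS : MeasurableSet {x : Path K | (x h).2 = 0} :=
    (measurable_snd.comp (measurable_pi_apply h)) (measurableSet_singleton 0)
  exact hM.markov_additive i t A hA j _ hS

end IsMarkovAdditive

/-! ### Pathwise limit of the grid sums -/

namespace IsNondecreasing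

variable {Ω : Type*} [MeasurableSpace Ω] {K : ℕ} {M : Params K} {P : Fin K → Measure Ω}
  {ξ : ℝ≥0 → Ω → EReal} {J : ℝ≥0 → Ω → Fin (K + 1)} {ω : Ω} {p : ℝ}

theorem tendsto_tsum_gridTerm_of_dead (hM : IsNondecreasing M P ξ J) (p : ℝ)
    (h0 : J 0 ω ≠ 0) (hω : ∃ t, J t ω = 0) :
    Tendsto (fun h => ∑' n, gridTerm ξ J p h n ω) (𝓝[>] 0)
      (𝓝 (expWeight p (deathPosition ξ ω))) := by
  choose! s hs1 hs2 hs3 using fun (h : ℝ≥0) (hh : 0 < h) =>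
    hM.exists_tsum_gridTerm_eq p hh h0 hω
  have hlim : Tendsto (fun h => ξ (s h) ω) (𝓝[>] 0) (𝓝 (deathPosition ξ ω)) := by
    refine tendsto_order.mpr ⟨fun a ha => ?_, fun b hb => ?_⟩
    · obtain ⟨t, ht, hat⟩ := hM.exists_lt_of_lt_deathPosition ha
      -- A later live time `u` leaves room: if h < u - t, then t + h < u < s h + h, so the last live
      -- grid time `s h` has passed `t`.
      obtain ⟨u, htu, hu⟩ := hM.exists_gt_type_ne_zero ht
      filter_upwards [Ioo_mem_nhdsGT (tsub_pos_of_lt htu)] with h hh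
      refine hat.trans_le (hM.monotone ω ?_)
      have h1 : t + h < s h + h :=
        (add_comm t h ▸ lt_tsub_iff_right.mp hh.2).trans (hM.lt_of_type hu (hs2 h hh.1))
      exact (lt_of_add_lt_add_right h1).le
    · filter_upwards [self_mem_nhdsWithin] with h hh
      exact (hM.le_deathPosition (hs1 h hh)).trans_lt hb
  refine (((continuous_expWeight p).tendsto _).comp hlim).congr' ?_
  filter_upwards [self_mem_nhdsWithin] with h hh
  exact (hs3 h hh).symm

/-- On an immortal path every grid term is 0, so the weight at the limit must be 0. For p ≥ 0 it is
at most each weight at time n, and these tend to 0. For p < 0 those weights are at least 1, which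
contradicts `hZ`. -/
theorem tendsto_tsum_gridTerm (hM : IsNondecreasing M P ξ J)
    (h0 : ξ 0 ω = 0) (h0' : J 0 ω ≠ 0)
    (hZ : Tendsto (fun n : ℕ => ENNReal.ofReal
      (extend (fun _ x => Real.exp (-p * x)) (ξ n ω) (J n ω))) atTop (𝓝 0)) :
    Tendsto (fun h => ∑' n, gridTerm ξ J p h n ω) (𝓝[>] 0)
      (𝓝 (expWeight p (deathPosition ξ ω))) := by
  by_cases hω : ∃ t, J t ω = 0
  · exact hM.tendsto_tsum_gridTerm_of_dead p h0' hω
  push Not at hω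
  simp only [hM.ofReal_extend_exp p (hω _)] at hZ
  simp only [IsMarkovAdditive.tsum_gridTerm_eq_zero p _ hω]
  have hD : expWeight p (deathPosition ξ ω) = 0 := by
    rcases le_or_gt 0 p with hp | hp
    · exact le_antisymm (ge_of_tendsto' hZ fun n =>
        expWeight_anti hp (hM.le_deathPosition (hω n))) zero_le
    · have : (1 : ℝ≥0∞) ≤ 0 := ge_of_tendsto' hZ fun n => by
        rw [← expWeight_zero p, ← h0]
        exact expWeight_mono hp.le (hM.monotone ω zero_le)
      simp at this
  rw [hD]
  exact tendsto_const_nhds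

theorem tsum_gridTerm_le_one (hM : IsNondecreasing M P ξ J) (hp : 0 ≤ p) {h : ℝ≥0} (hh : 0 < h)
    (h0 : ξ 0 ω = 0) (h0' : J 0 ω ≠ 0) : ∑' n, gridTerm ξ J p h n ω ≤ 1 := by
  by_cases hω : ∃ t, J t ω = 0
  · obtain ⟨s, -, -, hs⟩ := hM.exists_tsum_gridTerm_eq p hh h0' hω
    rw [hs, ← expWeight_zero p, ← h0]
    exact expWeight_anti hp (hM.monotone ω zero_le)
  · push Not at hω
    rw [IsMarkovAdditive.tsum_gridTerm_eq_zero p h hω]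
    exact zero_le

theorem tsum_gridTerm_le (hM : IsNondecreasing M P ξ J) (hp : p ≤ 0) {h : ℝ≥0} (hh : 0 < h)
    (h0' : J 0 ω ≠ 0) : ∑' n, gridTerm ξ J p h n ω ≤ expWeight p (deathPosition ξ ω) := by
  by_cases hω : ∃ t, J t ω = 0
  · obtain ⟨s, hs1, -, hs⟩ := hM.exists_tsum_gridTerm_eq p hh h0' hω
    rw [hs]
    exact expWeight_mono hp (hM.le_deathPosition hs1)
  · push Not at hω
    rw [IsMarkovAdditive.tsum_gridTerm_eq_zero p h hω]
    exact zero_le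

/-! ### Means along a grid -/

theorem extend_single_nonneg (p : ℝ) (l : Fin K) (x : EReal) (j : Fin (K + 1)) :
    0 ≤ extend (fun m x => (Pi.single l 1 : Fin K → ℝ) m * Real.exp (-p * x)) x j := by
  cases j using Fin.cases with
  | zero => simp
  | succ m =>
    simp only [extend_succ, Pi.single_apply]
    split_ifs <;> simp [(Real.exp_pos _).le]

theorem momentMatrix_nonneg (P : Fin K → Measure Ω) (ξ : ℝ≥0 → Ω → EReal)
    (J : ℝ≥0 → Ω → Fin (K + 1)) (p t : ℝ) (i j : Fin K) :
    0 ≤ momentMatrix P ξ J p t i j :=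
  integral_nonneg fun _ => extend_single_nonneg p j _ _

theorem lintegral_single (hM : IsNondecreasing M P ξ J)
    (hp : M.lowerExponent < (p : EReal)) (i j : Fin K) (t : ℝ≥0) :
    ∫⁻ ω, ENNReal.ofReal (extend (fun l x => (Pi.single j 1 : Fin K → ℝ) l * Real.exp (-p * x))
      (ξ t ω) (J t ω)) ∂(P i) = ENNReal.ofReal (momentMatrix P ξ J p t i j) := by
  rw [← ofReal_integral_eq_lintegral_ofReal (hM.integrable_extend_exp hp _ i t)
    (ae_of_all _ fun ω => extend_single_nonneg p j _ _)]
  simp [momentMatrix, meanAt]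

theorem ofReal_extend_eq_sum (p : ℝ) (x : EReal) (j : Fin (K + 1)) :
    ENNReal.ofReal (extend (fun _ x => Real.exp (-p * x)) x j) = ∑ l : Fin K, ENNReal.ofReal
      (extend (fun m x => (Pi.single l 1 : Fin K → ℝ) m * Real.exp (-p * x)) x j) := by
  cases j using Fin.cases with
  | zero => simp
  | succ m =>
    simp only [extend_succ]
    rw [Finset.sum_eq_single m]
    · simp
    · intro l _ hl
      simp [hl.symm]
    · simp

theorem lintegral_exp_eq (hM : IsNondecreasing M P ξ J)
    (hp : M.lowerExponent < (p : EReal)) (i : Fin K) (t : ℝ≥0) :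
    ∫⁻ ω, ENNReal.ofReal (extend (fun _ x => Real.exp (-p * x)) (ξ t ω) (J t ω)) ∂(P i) =
      ENNReal.ofReal ((momentMatrix P ξ J p t).mulVec 1 i) := by
  simp only [ofReal_extend_eq_sum]
  rw [lintegral_finsetSum _ fun l _ =>
    (hM.measurable_extend (fun _ => by fun_prop) t).ennreal_ofReal]
  simp only [hM.lintegral_single hp]
  rw [← ENNReal.ofReal_sum_of_nonneg fun j _ => momentMatrix_nonneg P ξ J p t i j]
  simp [Matrix.mulVec, dotProduct]

/-- The probability of death before time `h`, as a function of the starting type. -/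
noncomputable def _root_.MAP.deathProb (P : Fin K → Measure Ω) (J : ℝ≥0 → Ω → Fin (K + 1))
    (h : ℝ) (j : Fin K) : ℝ := (P j).real {ω | J h.toNNReal ω = 0}

theorem deathProb_nonneg (P : Fin K → Measure Ω) (J : ℝ≥0 → Ω → Fin (K + 1)) (h : ℝ)
    (j : Fin K) : 0 ≤ deathProb P J h j := measureReal_nonneg

theorem momentMatrix_mulVec_deathProb_nonneg (P : Fin K → Measure Ω) (ξ : ℝ≥0 → Ω → EReal)
    (J : ℝ≥0 → Ω → Fin (K + 1)) (p t h : ℝ) (i : Fin K) :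
    0 ≤ (momentMatrix P ξ J p t).mulVec (deathProb P J h) i := by
  simp only [Matrix.mulVec, dotProduct]
  exact Finset.sum_nonneg fun j _ =>
    mul_nonneg (momentMatrix_nonneg P ξ J p t i j) (deathProb_nonneg P J h j)

/-- Split by the type at time n h; the Markov property factors each piece into a moment up to n h
and a probability of death during the next step. -/
theorem lintegral_gridTerm (hM : IsNondecreasing M P ξ J)
    (hp : M.lowerExponent < (p : EReal)) (i : Fin K) (h : ℝ≥0) (n : ℕ) :
    ∫⁻ ω, gridTerm ξ J p h n ω ∂(P i) =
      ENNReal.ofReal ((momentMatrix P ξ J p (n * h)).mulVec (deathProb P J h) i) := by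
  have hD : MeasurableSet {ω | J (n * h + h) ω = 0} :=
    hM.measurable_type _ (measurableSet_singleton _)
  unfold gridTerm
  rw [lintegral_indicator hD]
  simp only [ofReal_extend_eq_sum]
  rw [lintegral_finsetSum _ fun l _ =>
    (hM.measurable_extend (fun _ => by fun_prop) _).ennreal_ofReal]
  have key : ∀ l, ∫⁻ ω in {ω | J (n * h + h) ω = 0}, ENNReal.ofReal
      (extend (fun m x => (Pi.single l 1 : Fin K → ℝ) m * Real.exp (-p * x))
        (ξ (n * h) ω) (J (n * h) ω)) ∂(P i) =
      ENNReal.ofReal (momentMatrix P ξ J p (n * h) i l * deathProb P J h l) := fun l => by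
    have := hM.isProbabilityMeasure l
    have hB : MeasurableSet {ω | J (n * h) ω = l.succ} :=
      hM.measurable_type _ (measurableSet_singleton _)
    set F : Ω → ℝ≥0∞ := fun ω => ENNReal.ofReal
      (extend (fun m x => (Pi.single l 1 : Fin K → ℝ) m * Real.exp (-p * x))
        (ξ (n * h) ω) (J (n * h) ω)) with hF
    -- `F` lives on the event of type `l`, so that event can be inserted freely to match
    -- `setLIntegral_type_death`.
    have hind : {ω | J (n * h) ω = l.succ}.indicator F = F := by
      refine indicator_eq_self.mpr fun ω hω => ?_
      rw [Function.mem_support, hF] at hω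
      by_contra hne
      refine hω ?_
      rw [mem_ofPred_eq] at hne
      dsimp only
      revert hne
      cases J (n * h) ω using Fin.cases with
      | zero => simp
      | succ m =>
        intro hne
        have : m ≠ l := fun e => hne (e ▸ rfl)
        simp [Pi.single_apply, this]
    have hmeas : Measurable[past ξ J (n * h)] F :=
      ENNReal.measurable_ofReal.comp
        (IsMarkovAdditive.measurable_past_extend (fun _ => by fun_prop) _)
    have h1 : ∫⁻ ω, F ω ∂(P i) = ENNReal.ofReal (momentMatrix P ξ J p (n * h) i l) := by
      have := hM.lintegral_single hp i l (n * h)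
      rwa [NNReal.coe_mul, NNReal.coe_natCast] at this
    rw [← hind, lintegral_indicator hB, Measure.restrict_restrict hB,
      hM.setLIntegral_type_death i l _ h hmeas, ← lintegral_indicator hB, hind, h1,
      ENNReal.ofReal_mul (momentMatrix_nonneg _ _ _ _ _ _ _)]
    simp [deathProb, Measure.real, ENNReal.ofReal_toReal]
  simp only [key]
  rw [← ENNReal.ofReal_sum_of_nonneg fun j _ =>
    mul_nonneg (momentMatrix_nonneg P ξ J p _ i j) (deathProb_nonneg P J h j)]
  rfl

theorem lintegral_tsum_gridTerm (hM : IsNondecreasing M P ξ J)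
    (hp : M.lowerExponent < (p : EReal)) (hpos : 0 < -maxRealPart (-M.bernstein p)) (i : Fin K)
    {h : ℝ≥0} (hh : 0 < h) :
    ∫⁻ ω, ∑' n, gridTerm ξ J p h n ω ∂(P i) = ENNReal.ofReal
      ((1 - NormedSpace.exp (-((h : ℝ) • M.bernstein p)))⁻¹.mulVec (deathProb P J h) i) := by
  rw [lintegral_tsum fun n => (hM.measurable_gridTerm p h n).aemeasurable]
  simp only [hM.lintegral_gridTerm hp]
  have hs := (hasSum_exp_pow hpos (t := h) (by exact_mod_cast hh)).map
    (Matrix.mulVecBilin ℝ ℝ |>.flip (deathProb P J h)) (by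
      exact continuous_id.matrix_mulVec continuous_const)
  have hs' := Pi.hasSum.mp hs i
  have e : ∀ n : ℕ, (momentMatrix P ξ J p (n * h)).mulVec (deathProb P J h) i =
      (NormedSpace.exp (-((h : ℝ) • M.bernstein p)) ^ n).mulVec (deathProb P J h) i := fun n => by
    rw [hM.momentMatrix_nsmul hp h.coe_nonneg]
  have hnn : ∀ n : ℕ, 0 ≤ (momentMatrix P ξ J p (n * h)).mulVec (deathProb P J h) i := fun n =>
    momentMatrix_mulVec_deathProb_nonneg P ξ J p _ h i
  have hs'' : HasSum (fun n : ℕ => (momentMatrix P ξ J p (n * h)).mulVec (deathProb P J h) i)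
      ((1 - NormedSpace.exp (-((h : ℝ) • M.bernstein p)))⁻¹.mulVec (deathProb P J h) i) := by
    simp only [e]
    exact hs'
  rw [← ENNReal.ofReal_tsum_of_nonneg hnn hs''.summable, hs''.tsum_eq]

/-- The expectations sum to a convergent geometric series of matrices, so the series of weights is
almost surely finite and its terms tend to 0. -/
theorem ae_tendsto_zero (hM : IsNondecreasing M P ξ J)
    (hp : M.lowerExponent < (p : EReal)) (hpos : 0 < -maxRealPart (-M.bernstein p)) (i : Fin K) :
    ∀ᵐ ω ∂(P i), Tendsto (fun n : ℕ => ENNReal.ofReal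
      (extend (fun _ x => Real.exp (-p * x)) (ξ n ω) (J n ω))) atTop (𝓝 0) := by
  have hmeas : ∀ n : ℕ, Measurable fun ω => ENNReal.ofReal
      (extend (fun _ x => Real.exp (-p * x)) (ξ n ω) (J n ω)) := fun n =>
    (hM.measurable_extend (fun _ => by fun_prop) _).ennreal_ofReal
  have hfin : ∫⁻ ω, ∑' n : ℕ, ENNReal.ofReal
      (extend (fun _ x => Real.exp (-p * x)) (ξ n ω) (J n ω)) ∂(P i) ≠ ⊤ := by
    rw [lintegral_tsum fun n => (hmeas n).aemeasurable]
    simp only [hM.lintegral_exp_eq hp]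
    have hs := (summable_exp_pow hpos one_pos).map
      (Matrix.mulVecBilin ℝ ℝ |>.flip (1 : Fin K → ℝ)) (by
        exact continuous_id.matrix_mulVec continuous_const)
    have hs' := Pi.summable.mp hs i
    refine Summable.tsum_ofReal_ne_top (hs'.congr fun n => ?_)
    have := hM.momentMatrix_nsmul hp zero_le_one n
    rw [mul_one] at this
    simp [this]
  filter_upwards [ae_lt_top (Measurable.tsum hmeas) hfin] with ω hω
  exact ENNReal.tendsto_atTop_zero_of_tsum_ne_top hω.ne

/-! ### Small-time death probabilities and passage to the limit -/

/-- Apply Dynkin's formula to the constant 1, whose image under the generator is minus the killing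
rate: the survival probability has that right derivative at 0. -/
theorem tendsto_deathProb (hM : IsNondecreasing M P ξ J) :
    Tendsto (fun h : ℝ => h⁻¹ • deathProb P J h) (𝓝[>] 0) (𝓝 M.kill) := by
  refine tendsto_pi_nhds.mpr fun j => ?_
  have := hM.isProbabilityMeasure j
  have htest : IsTest fun (_ : Fin K) (_ : ℝ) => (1 : ℝ) :=
    ⟨fun _ => contDiff_const, 1, fun _ _ => by simp⟩
  have hgen : M.generator (fun _ _ => 1) = fun i _ => -M.kill i := by
    ext i x; simp [Params.generator]
  have hd := (hM.hasDerivWithinAt_meanAt htest (C := ∑ i, |M.kill i|)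
    (Finset.sum_nonneg fun _ _ => abs_nonneg _) (fun i => by rw [hgen]; exact continuous_const)
    (fun i x => by
      rw [hgen, abs_neg]
      exact Finset.single_le_sum (f := fun j => |M.kill j|) (fun _ _ => abs_nonneg _)
        (Finset.mem_univ i)) j).2 0 le_rfl
  rw [hM.meanAt_start, hgen, hasDerivWithinAt_iff_tendsto_slope, Ici_sdiff_left] at hd
  have hd := hd.neg
  rw [neg_neg] at hd
  refine hd.congr fun h => ?_
  have hval : meanAt (P j) ξ J (fun _ _ => 1) h = 1 - deathProb P J h j := by
    have hD : MeasurableSet {ω | J h.toNNReal ω = 0} :=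
      hM.measurable_type _ (measurableSet_singleton _)
    have : (fun ω => extend (fun (_ : Fin K) _ => 1) (ξ h.toNNReal ω) (J h.toNNReal ω)) =
        {ω | J h.toNNReal ω = 0}ᶜ.indicator 1 := by
      ext ω
      rcases Fin.eq_zero_or_eq_succ (J h.toNNReal ω) with h0 | ⟨l, hl⟩
      · simp [h0]
      · simp [hl]
    rw [meanAt, this, integral_indicator_one hD.compl, probReal_compl_eq_one_sub hD]
    rfl
  rw [slope_def_field, hM.meanAt_start, hval]
  simp
  ring

theorem deathMoment_eq (hM : IsNondecreasing M P ξ J)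
    (hp : M.lowerExponent < (p : EReal)) (hpos : 0 < -maxRealPart (-M.bernstein p)) (i : Fin K) :
    deathMoment (P i) ξ p = ENNReal.ofReal ((M.bernstein p)⁻¹.mulVec M.kill i) := by
  have := hM.isProbabilityMeasure i
  have hstart : ∀ᵐ ω ∂(P i), ξ 0 ω = 0 ∧ J 0 ω ≠ 0 := by
    filter_upwards [hM.start i] with ω hω
    exact ⟨hω.1, hω.2 ▸ Fin.succ_ne_zero i⟩
  have hlim : ∀ᵐ ω ∂(P i), Tendsto (fun h => ∑' n, gridTerm ξ J p h n ω) (𝓝[>] 0)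
      (𝓝 (expWeight p (deathPosition ξ ω))) := by
    filter_upwards [hstart, hM.ae_tendsto_zero hp hpos i] with ω hω hZ
    exact hM.tendsto_tsum_gridTerm hω.1 hω.2 hZ
  have hmeas : ∀ h, Measurable fun ω => ∑' n, gridTerm ξ J p h n ω := fun h =>
    Measurable.tsum fun n => hM.measurable_gridTerm p h n
  have hcoe : Tendsto (fun h : ℝ≥0 => (h : ℝ)) (𝓝[>] 0) (𝓝[>] 0) :=
    tendsto_nhdsWithin_iff.mpr ⟨(NNReal.continuous_coe.tendsto' 0 0 rfl).mono_left
      nhdsWithin_le_nhds, by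
        filter_upwards [self_mem_nhdsWithin] with h hh
        exact NNReal.coe_pos.mpr hh⟩
  have hmean : Tendsto (fun h => ∫⁻ ω, ∑' n, gridTerm ξ J p h n ω ∂(P i)) (𝓝[>] 0)
      (𝓝 (ENNReal.ofReal ((M.bernstein p)⁻¹.mulVec M.kill i))) := by
    have h1 := tendsto_pi_nhds.mp
      ((tendsto_one_sub_exp_inv_mulVec hpos hM.tendsto_deathProb).comp hcoe) i
    refine ((ENNReal.continuous_ofReal.tendsto _).comp h1).congr' ?_
    filter_upwards [self_mem_nhdsWithin] with h hh
    exact (hM.lintegral_tsum_gridTerm hp hpos i hh).symm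
  change ∫⁻ ω, expWeight p (deathPosition ξ ω) ∂(P i) = _
  -- For p ≥ 0 the grid sums are at most 1. For p ≤ 0 they may be unbounded: Fatou gives one
  -- inequality, and the other holds because each grid sum is at most the weight at death.
  rcases le_total 0 p with h0 | h0
  · refine tendsto_nhds_unique (tendsto_lintegral_filter_of_dominated_convergence (fun _ => 1)
      (Eventually.of_forall hmeas) ?_ (by simp) hlim) hmean
    filter_upwards [self_mem_nhdsWithin] with h hh
    filter_upwards [hstart] with ω hω
    exact hM.tsum_gridTerm_le_one h0 hh hω.1 hω.2
  · refine le_antisymm ?_ (le_of_tendsto hmean ?_)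
    · rw [← hmean.liminf_eq]
      refine le_trans (lintegral_mono_ae ?_) (lintegral_liminf_le hmeas)
      filter_upwards [hlim] with ω hω
      exact hω.liminf_eq.ge
    · filter_upwards [self_mem_nhdsWithin] with h hh
      refine lintegral_mono_ae ?_
      filter_upwards [hstart] with ω hω
      exact hM.tsum_gridTerm_le h0 hh hω.2

/-- A limit of sums of nonnegative moments. It is needed because `ENNReal.ofReal` in
`deathMoment_eq` would send a negative entry to 0. -/
theorem inv_mulVec_kill_nonneg (hM : IsNondecreasing M P ξ J)
    (hp : M.lowerExponent < (p : EReal)) (hpos : 0 < -maxRealPart (-M.bernstein p)) (i : Fin K) :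
    0 ≤ (M.bernstein p)⁻¹.mulVec M.kill i := by
  refine ge_of_tendsto (tendsto_pi_nhds.mp
    (tendsto_one_sub_exp_inv_mulVec hpos hM.tendsto_deathProb) i) ?_
  filter_upwards [self_mem_nhdsWithin] with h hh
  have hs := (hasSum_exp_pow hpos hh).map
    (Matrix.mulVecBilin ℝ ℝ |>.flip (deathProb P J h)) (by
      exact continuous_id.matrix_mulVec continuous_const)
  refine (Pi.hasSum.mp hs i).nonneg fun n => ?_
  change 0 ≤ ((NormedSpace.exp (-(h • M.bernstein p)) ^ n).mulVec (deathProb P J h)) i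
  rw [← hM.momentMatrix_nsmul hp (le_of_lt hh)]
  exact momentMatrix_mulVec_deathProb_nonneg P ξ J p _ h i

end IsNondecreasing

end MAP

theorem mainTheorem4 {K : ℕ} (M : MAP.Params K) (hirr : M.Irreducible)
    (hkill : ∃ i, 0 < M.kill i)
    {Ω : Type*} [MeasurableSpace Ω] (P : Fin K → MeasureTheory.Measure Ω)
    (ξ : NNReal → Ω → EReal) (J : NNReal → Ω → Fin (K + 1))
    (hMAP : MAP.IsNondecreasing M P ξ J)
    (p : ℝ) (hp : M.lowerExponent < (p : EReal))
    (hpos : 0 < -MAP.maxRealPart (-M.bernstein p)) :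
    IsUnit (M.bernstein p) ∧
      (∀ i, MAP.deathMoment (P i) ξ p ≠ ⊤) ∧
      (fun i => (MAP.deathMoment (P i) ξ p).toReal) = (M.bernstein p)⁻¹.mulVec M.kill := by
  refine ⟨MAP.isUnit_of_neg_maxRealPart_neg_pos hpos, fun i => ?_, funext fun i => ?_⟩
  · rw [hMAP.deathMoment_eq hp hpos]
    exact ENNReal.ofReal_ne_top
  · rw [hMAP.deathMoment_eq hp hpos,
      ENNReal.toReal_ofReal (hMAP.inv_mulVec_kill_nonneg hp hpos i)]
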